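/- Notation. Let $B(x)=B_0+B_1(x)$, $x\in\mathbb R^2$, where $B_0>0$ is a constant and $B_1:\mathbb R^2\to\mathbb R$ is differentiable with bounded gradient, and let $V:\mathbb R^2\to\mathbb R$ be bounded and differentiable with bounded gradient. Let $A:\mathbb R^2\to\mathbb R^2$ be any differentiable vector potential of $B$, i.e. $\partial_1A_2-\partial_2A_1=B$, and let $H(B)=(p-A)^2+V$, $p=-i\nabla$, be the magnetic Schrödinger operator on $L^2(\mathbb R^2)$, realised as the Friedrichs extension, that is, as the self-adjoint operator associated with the closure of the quadratic form $\varphi\mapsto\|(p-A)\varphi\|^2+\langle\varphi,V\varphi\rangle$, $\varphi\in C_c^\infty(\mathbb R^2)$. For $n\in\mathbb N=\{0,1,2,\dots\}$ put $$e_{n,\min}[B]=\inf_{x\in\mathbb R^2}\big[(2n+1)B(x)+V(x)\big],\qquad e_{n,\max}[B]=\sup_{x\in\mathbb R^2}\big[(2n+1)B(x)+V(x)\big],$$ $$\hat K_2=\|\nabla B_1\|_\infty+\|\nabla V\|_\infty,\qquad \hat K_3=\|\nabla B_1\|_\infty^2 .$$ Theorem. Let $C_1>0$. There are constants $C_{\mathrm{ext},n}\ge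 0$, $n\in\mathbb N$, depending only on $n$ and $C_1$, such that the following holds for all $B_0,B_1,V,A$ as above with $$C_1^{-1}B_0\le B(x)\le C_1B_0\qquad\text{for all }x\in\mathbb R^2 .$$ For every $n\in\mathbb N$ the interval $\big(\hat I_n^+[B],\hat I_{n+1}^-[B]\big)$ with $$\hat I_n^+[B]=e_{n,\max}[B]+C_{\mathrm{ext},n}\big[\hat K_2B_0^{-1/2}+\hat K_3B_0^{-2}\big],$$ $$\hat I_{n+1}^-[B]=e_{n+1,\min}[B]-C_{\mathrm{ext},n+1}\big[\hat K_2B_0^{-1/2}+\hat K_3B_0^{-2}\big]$$ is contained in the resolvent set of $H(B)$. -/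

import Mathlib

open MeasureTheory Set TopologicalSpace
open scoped ContDiff BoundedContinuousFunction Distributions LinearPMap

namespace MagneticSchrodinger

noncomputable section

/-- The Euclidean plane `ℝ²` (coordinates are indexed by `0, 1`). -/
abbrev Plane : Type := EuclideanSpace ℝ (Fin 2)

/-- `L²(ℝ²; ℂ)`. -/
abbrev L2 : Type := Lp ℂ 2 (volume : Measure Plane)

/-- `L²(ℝ²; ℂ²)`. -/
abbrev L2Vec : Type := Lp (EuclideanSpace ℂ (Fin 2)) 2 (volume : Measure Plane)

/-- Complex-valued test functions `C_c^∞(ℝ²)`. -/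
abbrev Test : Type := 𝓓((⊤ : Opens Plane), ℂ)

/-- The standard basis vectors of the plane. -/
abbrev e (j : Fin 2) : Plane := EuclideanSpace.single j 1

/-- `A` is a (differentiable) vector potential of the magnetic field `B`:
`∇ × A = ∂₁ A₂ - ∂₂ A₁ = B`. -/
def IsVectorPotential (A : Plane → Plane) (B : Plane → ℝ) : Prop :=
  Differentiable ℝ A ∧ ∀ x, fderiv ℝ A x (e 0) 1 - fderiv ℝ A x (e 1) 0 = B x

/-- `(p - A) φ = -i ∇φ - A φ` for a test function `φ`, as a `ℂ²`-valued function. -/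
def momentumFun (A : C(Plane, Plane)) (φ : Test) (x : Plane) : EuclideanSpace ℂ (Fin 2) :=
  WithLp.toLp 2 fun j => -Complex.I * fderiv ℝ φ x (e j) - (A x j : ℂ) * φ x

theorem memLp_test (φ : Test) : MemLp φ 2 (volume : Measure Plane) :=
  φ.continuous.memLp_of_hasCompactSupport φ.hasCompactSupport

theorem memLp_momentumFun (A : C(Plane, Plane)) (φ : Test) :
    MemLp (momentumFun A φ) 2 (volume : Measure Plane) := by
  have hc : Continuous (fderiv ℝ (φ : Plane → ℂ)) := φ.contDiff.continuous_fderiv (by simp)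
  apply Continuous.memLp_of_hasCompactSupport
  · apply (PiLp.continuous_toLp 2 _).comp
    apply continuous_pi
    intro j
    have hA : Continuous fun x => A x j :=
      (EuclideanSpace.proj (𝕜 := ℝ) j).continuous.comp A.continuous
    exact (continuous_const.mul (hc.clm_apply continuous_const)).sub
      ((Complex.continuous_ofReal.comp hA).mul φ.continuous)
  · apply HasCompactSupport.intro φ.hasCompactSupport
    intro x hx
    have h0 : φ x = 0 := image_eq_zero_of_notMem_tsupport hx
    have h1 : fderiv ℝ (φ : Plane → ℂ) x = 0 := fderiv_of_notMem_tsupport ℝ hx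
    ext j
    simp [momentumFun, h0, h1]

/-- The inclusion `C_c^∞(ℝ²) → L²(ℝ²)`. -/
def testToL2 : Test →ₗ[ℂ] L2 where
  toFun φ := (memLp_test φ).toLp φ
  map_add' _ _ := rfl
  map_smul' _ _ := rfl

theorem testToL2_injective : Function.Injective testToL2 := by
  intro φ ψ h
  have h' : (φ : Plane → ℂ) =ᵐ[volume] ψ := 
    (MemLp.toLp_eq_toLp_iff (memLp_test φ) (memLp_test ψ)).1 h
  exact DFunLike.coe_injective ((φ.continuous.ae_eq_iff_eq volume ψ.continuous).1 h')

/-- `φ ↦ (p - A) φ` as a linear map `C_c^∞(ℝ²) → L²(ℝ²; ℂ²)`. -/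
def momentumTest (A : C(Plane, Plane)) : Test →ₗ[ℂ] L2Vec where
  toFun φ := (memLp_momentumFun A φ).toLp (momentumFun A φ)
  map_add' φ ψ := by
    rw [← MemLp.toLp_add]
    congr 1
    funext x
    ext j
    have : fderiv ℝ ((φ + ψ : Test) : Plane → ℂ) x = fderiv ℝ φ x + fderiv ℝ ψ x :=
      fderiv_add (φ.contDiff.differentiable (by simp) x) (ψ.contDiff.differentiable (by simp) x)
    simp only [momentumFun, this]
    simp [momentumFun]
    ring
  map_smul' c φ := by
    rw [RingHom.id_apply, ← MemLp.toLp_const_smul]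
    congr 1
    funext x
    ext j
    have : fderiv ℝ ((c • φ : Test) : Plane → ℂ) x = c • fderiv ℝ φ x :=
      fderiv_const_smul (φ.contDiff.differentiable (by simp) x) c
    simp only [momentumFun, this]
    simp [momentumFun]
    ring

/-- The operator `p - A` from `L²(ℝ²)` to `L²(ℝ²; ℂ²)` with domain `C_c^∞(ℝ²)`. -/
def momentum (A : C(Plane, Plane)) : L2 →ₗ.[ℂ] L2Vec where
  domain := LinearMap.range testToL2
  toFun := momentumTest A ∘ₗ (LinearEquiv.ofInjective testToL2 testToL2_injective).symm

/-- The operator `D* D̄` of a densely defined closable operator `D`: its domain consists of the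
`ψ` in the domain of the closure `D̄` with `D̄ ψ` in the domain of the adjoint `D*`. It is the
self-adjoint operator associated with the closure of the quadratic form `φ ↦ ‖D φ‖²`. -/
def adjointCompClosure (D : L2 →ₗ.[ℂ] L2Vec) : L2 →ₗ.[ℂ] L2 :=
  D†.comp
    (D.closure.domRestrict ((D†.domain.comap D.closure.toFun).map D.closure.domain.subtype))
    (by
      rintro ⟨x, hx, hx'⟩
      obtain ⟨y, hy, rfl⟩ := hx
      exact hy)

theorem memLp_potential (V : Plane →ᵇ ℝ) (ψ : L2) :
    MemLp (fun x => (V x : ℂ) * ψ x) 2 (volume : Measure Plane) := by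
  refine (Lp.memLp ψ).of_le_mul (c := ‖V‖)
    ((Complex.continuous_ofReal.comp V.continuous).aestronglyMeasurable.mul
      (Lp.aestronglyMeasurable ψ)) ?_
  filter_upwards with x
  rw [norm_mul, Complex.norm_real]
  exact mul_le_mul_of_nonneg_right (V.norm_coe_le_norm x) (norm_nonneg _)

/-- Multiplication by a bounded potential `V` on `L²(ℝ²)`. -/
def potential (V : Plane →ᵇ ℝ) : L2 →ₗ[ℂ] L2 where
  toFun ψ := (memLp_potential V ψ).toLp _
  map_add' ψ χ := by
    rw [← MemLp.toLp_add]
    apply MemLp.toLp_congr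
    filter_upwards [Lp.coeFn_add ψ χ] with x hx
    rw [hx]
    simp [mul_add]
  map_smul' c ψ := by
    rw [RingHom.id_apply, ← MemLp.toLp_const_smul]
    apply MemLp.toLp_congr
    filter_upwards [Lp.coeFn_smul c ψ] with x hx
    rw [hx]
    simp [mul_left_comm]

/-- The magnetic Schrödinger operator `H(A) = (p - A)² + V` on `L²(ℝ²)`, realised as the Friedrichs
extension, i.e. as the self-adjoint operator associated with the closure of the quadratic form
`φ ↦ ‖(p - A) φ‖² + ⟨φ, V φ⟩`, `φ ∈ C_c^∞(ℝ²)`. Since `V` is bounded, this is `D* D̄ + V` with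
`D = p - A` on `C_c^∞(ℝ²)`. -/
def hamiltonian (A : C(Plane, Plane)) (V : Plane →ᵇ ℝ) : L2 →ₗ.[ℂ] L2 :=
  potential V +ᵥ adjointCompClosure (momentum A)

/-- The resolvent set of an unbounded operator `T`: all `z` such that `T - z` is a bijection from
the domain of `T` onto the whole space with bounded inverse `R`. -/
def resolventSet (T : L2 →ₗ.[ℂ] L2) : Set ℂ :=
  {z | ∃ R : L2 →L[ℂ] L2,
    (∀ f : L2, ∃ h : R f ∈ T.domain, T ⟨R f, h⟩ - z • R f = f) ∧
    ∀ ψ : T.domain, R (T ψ - z • (ψ : L2)) = ψ}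

/-- The classical band edge `e_{n,min}[B] = inf_x [(2n+1) B(x) + V(x)]`. -/
def eMin (V B : Plane → ℝ) (n : ℕ) : ℝ := ⨅ x, ((2 * n + 1) * B x + V x)

/-- The classical band edge `e_{n,max}[B] = sup_x [(2n+1) B(x) + V(x)]`. -/
def eMax (V B : Plane → ℝ) (n : ℕ) : ℝ := ⨆ x, ((2 * n + 1) * B x + V x)

/-- `f` is differentiable with bounded gradient. -/
def HasBoundedGradient (f : Plane → ℝ) : Prop :=
  Differentiable ℝ f ∧ BddAbove (range fun x => ‖fderiv ℝ f x‖)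

/-- `‖∇f‖_∞ = sup_x |∇f(x)|`, with the Euclidean length of the gradient. -/
def gradSup (f : Plane → ℝ) : ℝ := ⨆ x, ‖fderiv ℝ f x‖

/-- `K̂₂ = ‖∇B₁‖_∞ + ‖∇V‖_∞`. -/
def K2 (B₁ V : Plane → ℝ) : ℝ := gradSup B₁ + gradSup V

/-- `K̂₃ = ‖∇B₁‖_∞²`. -/
def K3 (B₁ : Plane → ℝ) : ℝ := gradSup B₁ ^ 2

/-- The correction `K̂₂ B₀^{-1/2} + K̂₃ B₀^{-2}`. -/
def correction (B₀ : ℝ) (B₁ V : Plane → ℝ) : ℝ :=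
  K2 B₁ V * B₀ ^ (-(1 / 2) : ℝ) + K3 B₁ * B₀ ^ (-2 : ℝ)

end

end MagneticSchrodinger

/-!
Let `a = π₁ + i π₂` and `c = π₁ - i π₂` with `π = p - A`. These are mutually adjoint and
`a c = c a + 2 B`, so that `H - E = c a + W` with `W = B + V - E`. Up to the commutator `[a, W]`,
which is controlled by the gradients, `a (c a + W) = (a c + W) a = (c a + W + 2 B) a`: a lower
bound for `c a + W + 2 B` bounds `a ψ` in terms of `(c a + W) ψ`. The component of `ψ` in `ker a`
is bounded because `W ≤ -d` there, and the remaining component is bounded by `a ψ` since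
`a c ≥ 2 B`. Iterating this from `W + 2 k B` to `W + 2 (k + 1) B` passes through the Landau levels
`k ≤ n` lying below `E` and ends at `W + 2 (n + 1) B = (2 n + 3) B + V - E ≥ d`, where `c a ≥ 0`
gives the bound.
-/

open Filter Topology
open scoped InnerProductSpace ComplexConjugate Convolution

namespace MagneticSchrodinger

noncomputable section

section LinearRelation

variable {𝕜 E F 𝓗 : Type*} [RCLike 𝕜]
  [NormedAddCommGroup E] [InnerProductSpace 𝕜 E] [NormedAddCommGroup F] [InnerProductSpace 𝕜 F]
  [NormedAddCommGroup 𝓗] [InnerProductSpace 𝕜 𝓗]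

/-- The sum of a linear relation, such as the graph of an unbounded operator, and a bounded
operator. -/
def addBounded (T : Submodule 𝕜 (E × F)) (W : E →L[𝕜] F) : Submodule 𝕜 (E × F) :=
  T.comap (LinearMap.prod (LinearMap.fst 𝕜 E F)
    (LinearMap.snd 𝕜 E F - (W : E →ₗ[𝕜] F) ∘ₗ LinearMap.fst 𝕜 E F))

/-- The linear relation `T` is bounded below by `K⁻¹`. -/
def IsBoundedBelow (T : Submodule 𝕜 (E × F)) (K : ℝ) : Prop :=
  ∀ p ∈ T, ‖p.1‖ ≤ K * ‖p.2‖

theorem mem_addBounded {T : Submodule 𝕜 (E × F)} {W : E →L[𝕜] F} {p : E × F} :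
    p ∈ addBounded T W ↔ (p.1, p.2 - W p.1) ∈ T :=
  Iff.rfl

theorem addBounded_addBounded (T : Submodule 𝕜 (E × F)) (W W' : E →L[𝕜] F) :
    addBounded (addBounded T W) W' = addBounded T (W + W') := by
  ext p
  simp only [mem_addBounded, add_apply, sub_sub, add_comm (W p.1)]

theorem isClosed_adjoint (T : Submodule 𝕜 (E × F)) : IsClosed (T.adjoint : Set (F × E)) := by
  have h : (T.adjoint : Set (F × E)) =
      ⋂ q ∈ T, {p | ⟪q.2, p.1⟫_𝕜 - ⟪q.1, p.2⟫_𝕜 = 0} := by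
    ext p
    simp
  rw [h]
  exact isClosed_biInter fun q _ => isClosed_eq (by fun_prop) continuous_const

theorem adjoint_topologicalClosure (T : Submodule 𝕜 (E × F)) :
    T.topologicalClosure.adjoint = T.adjoint := by
  ext p
  rw [Submodule.mem_adjoint_iff, Submodule.mem_adjoint_iff]
  refine ⟨fun h a b hab => h a b (T.le_topologicalClosure hab), fun h a b hab => ?_⟩
  have hclosed : IsClosed {q : E × F | ⟪q.2, p.1⟫_𝕜 - ⟪q.1, p.2⟫_𝕜 = 0} :=
    isClosed_eq (by fun_prop) continuous_const
  exact closure_minimal (fun q hq => h q.1 q.2 hq) hclosed hab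

theorem adjoint_addBounded {T : Submodule 𝕜 (𝓗 × 𝓗)} (hT : T.adjoint = T) {W : 𝓗 →L[𝕜] 𝓗}
    (hW : W.IsSymmetric) : (addBounded T W).adjoint = addBounded T W := by
  ext p
  rw [mem_addBounded, ← hT, Submodule.mem_adjoint_iff, Submodule.mem_adjoint_iff]
  have key (a b : 𝓗) : ⟪b + W a, p.1⟫_𝕜 - ⟪a, p.2⟫_𝕜 = ⟪b, p.1⟫_𝕜 - ⟪a, p.2 - W p.1⟫_𝕜 := by
    rw [inner_add_left, inner_sub_right, show ⟪W a, p.1⟫_𝕜 = ⟪a, W p.1⟫_𝕜 from hW a p.1]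
    ring
  refine ⟨fun h a b hab => ?_, fun h a b hab => ?_⟩
  · rw [← key]
    exact h _ _ (by simpa [mem_addBounded, hT] using hab)
  · have := h a (b - W a) (by simpa [mem_addBounded, hT] using hab)
    rwa [← key, sub_add_cancel] at this

theorem adjoint_eq_of_le_of_exists_sub_mem {T : Submodule 𝕜 (𝓗 × 𝓗)} (hT : T ≤ T.adjoint)
    (hsurj : ∀ v, ∃ u, (u, v - u) ∈ T) : T.adjoint = T := by
  refine le_antisymm (fun ⟨x, y⟩ hxy => ?_) hT
  obtain ⟨u, hu⟩ := hsurj (x + y)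
  have hmem : (x - u, -(x - u)) ∈ T.adjoint := by
    convert sub_mem hxy (hT hu) using 1
    exact Prod.ext rfl (show -(x - u) = y - (x + y - u) by abel)
  obtain ⟨z, hz⟩ := hsurj (x - u)
  have hxu : x = u := by
    have := (Submodule.mem_adjoint_iff T _).1 hmem z _ hz
    rw [inner_sub_left, inner_neg_right, sub_neg_eq_add, sub_add_cancel, inner_self_eq_zero] at this
    exact sub_eq_zero.1 this
  subst hxu
  simpa using hu

variable [CompleteSpace 𝓗]

theorem IsBoundedBelow.map_snd_eq_top {T : Submodule 𝕜 (𝓗 × 𝓗)} (hT : T.adjoint = T) {K : ℝ}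
    (hK : IsBoundedBelow T K) : T.map (LinearMap.snd 𝕜 𝓗 𝓗) = ⊤ := by
  set M := T.map (LinearMap.snd 𝕜 𝓗 𝓗)
  have hTc : IsClosed (T : Set (𝓗 × 𝓗)) := hT ▸ isClosed_adjoint T
  have : CompleteSpace T := hTc.completeSpace_coe
  have hanti : AntilipschitzWith (max K 1).toNNReal
      ((ContinuousLinearMap.snd 𝕜 𝓗 𝓗).comp T.subtypeL) := by
    refine ContinuousLinearMap.antilipschitz_of_bound _ fun p => ?_
    rw [Real.coe_toNNReal _ (by positivity), Submodule.coe_norm, Prod.norm_def]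
    refine max_le ((hK p p.2).trans ?_) (le_mul_of_one_le_left (norm_nonneg _) (le_max_right _ _))
    exact mul_le_mul_of_nonneg_right (le_max_left _ _) (norm_nonneg _)
  have hMc : IsClosed (M : Set 𝓗) := by
    convert hanti.isClosed_range (ContinuousLinearMap.uniformContinuous _)
    ext v
    simp [M]
  have : CompleteSpace M := hMc.completeSpace_coe
  rw [← Submodule.orthogonal_eq_bot_iff, Submodule.eq_bot_iff]
  intro g hg
  have hgT : (g, 0) ∈ T := by
    rw [← hT, Submodule.mem_adjoint_iff]
    intro a b hab
    rw [inner_zero_right, sub_zero]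
    exact (M.mem_orthogonal g).1 hg b ⟨_, hab, rfl⟩
  simpa using hK _ hgT

theorem IsBoundedBelow.exists_inverse {T : Submodule 𝕜 (𝓗 × 𝓗)} (hT : T.adjoint = T) {K : ℝ}
    (hK : IsBoundedBelow T K) : ∃ R : 𝓗 →L[𝕜] 𝓗, ∀ u v, (u, v) ∈ T ↔ R v = u := by
  let S : T →ₗ[𝕜] 𝓗 := LinearMap.snd 𝕜 𝓗 𝓗 ∘ₗ T.subtype
  have hinj : Function.Injective S := by
    refine (injective_iff_map_eq_zero S).2 fun p (hp : p.1.2 = 0) => ?_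
    have := hK p p.2
    rw [hp, norm_zero, mul_zero, norm_le_zero_iff] at this
    exact Subtype.ext (Prod.ext this hp)
  have hsurj : Function.Surjective S := fun v => by
    obtain ⟨p, hp, hpv⟩ : v ∈ T.map (LinearMap.snd 𝕜 𝓗 𝓗) :=
      hK.map_snd_eq_top hT ▸ Submodule.mem_top
    exact ⟨⟨p, hp⟩, hpv⟩
  let Φ := LinearEquiv.ofBijective S ⟨hinj, hsurj⟩
  have hΦ (v : 𝓗) : (Φ.symm v).1.2 = v := Φ.apply_symm_apply v
  refine ⟨(LinearMap.fst 𝕜 𝓗 𝓗 ∘ₗ T.subtype ∘ₗ Φ.symm.toLinearMap).mkContinuous K fun v => ?_,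
    fun u v => ⟨fun h => ?_, fun h => ?_⟩⟩
  · simpa [hΦ] using hK _ (Φ.symm v).2
  · have : Φ.symm v = ⟨(u, v), h⟩ := Φ.symm_apply_eq.2 rfl
    simp [this]
  · convert (Φ.symm v).2
    exacts [h.symm, (hΦ v).symm]

end LinearRelation

section Loewner

variable {𝓗 : Type*} [NormedAddCommGroup 𝓗] [InnerProductSpace ℂ 𝓗] {W : 𝓗 →L[ℂ] 𝓗} {d : ℝ}

theorem isSymmetric_of_smul_one_le (h : d • 1 ≤ W) : W.IsSymmetric := by
  have hd : (d • (1 : 𝓗 →L[ℂ] 𝓗)).IsSymmetric := fun u v => by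
    simp [inner_smul_left_eq_smul, inner_smul_right_eq_smul]
  simpa using ((ContinuousLinearMap.le_def _ _).1 h).isSymmetric.add hd

theorem mul_norm_sq_le_re_inner_of_smul_one_le (h : d • 1 ≤ W) (u : 𝓗) :
    d * ‖u‖ ^ 2 ≤ (⟪u, W u⟫_ℂ).re := by
  have := ((ContinuousLinearMap.le_def _ _).1 h).re_inner_nonneg_right u
  rw [sub_apply, inner_sub_right, map_sub, sub_nonneg] at this
  simpa [inner_smul_right_eq_smul, ← Complex.ofReal_pow] using this

end Loewner

/-- A pair of mutually adjoint closed operators `a`, `c` with a common domain and with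
`a c = c a + β` in the sense of quadratic forms, for a bounded operator `β`. -/
structure LadderPair (𝓗 : Type*) [NormedAddCommGroup 𝓗] [InnerProductSpace ℂ 𝓗] where
  /-- The common domain. -/
  dom : Submodule ℂ 𝓗
  /-- The annihilation operator. -/
  a : dom →ₗ[ℂ] 𝓗
  /-- The creation operator. -/
  c : dom →ₗ[ℂ] 𝓗
  /-- The commutator of `a` and `c`. -/
  β : 𝓗 →L[ℂ] 𝓗
  inner_a : ∀ u v : dom, ⟪a u, (v : 𝓗)⟫_ℂ = ⟪(u : 𝓗), c v⟫_ℂ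
  a_max : ∀ u g : 𝓗, (∀ v : dom, ⟪c v, u⟫_ℂ = ⟪(v : 𝓗), g⟫_ℂ) → ∃ h : u ∈ dom, a ⟨u, h⟩ = g
  c_max : ∀ u g : 𝓗, (∀ v : dom, ⟪a v, u⟫_ℂ = ⟪(v : 𝓗), g⟫_ℂ) → ∃ h : u ∈ dom, c ⟨u, h⟩ = g
  comm : ∀ u v : dom, ⟪c u, c v⟫_ℂ = ⟪a u, a v⟫_ℂ + ⟪(u : 𝓗), β v⟫_ℂ

namespace LadderPair

variable {𝓗 : Type*} [NormedAddCommGroup 𝓗] [InnerProductSpace ℂ 𝓗] (L : LadderPair 𝓗)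

theorem inner_c (u v : L.dom) : ⟪L.c u, (v : 𝓗)⟫_ℂ = ⟪(u : 𝓗), L.a v⟫_ℂ := by
  rw [← inner_conj_symm, ← L.inner_a v u, inner_conj_symm]

/-- The ladder pair in which creation and annihilation exchange their roles. -/
def swap : LadderPair 𝓗 where
  dom := L.dom
  a := L.c
  c := L.a
  β := -L.β
  inner_a := L.inner_c
  a_max := L.c_max
  c_max := L.a_max
  comm u v := by rw [L.comm, neg_apply, inner_neg_right, add_neg_cancel_right]

/-- The graph of `c a`, described as the operator associated with the quadratic form
`u ↦ ‖a u‖²`. -/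
def kinetic : Submodule ℂ (𝓗 × 𝓗) where
  carrier := {p | ∃ h : p.1 ∈ L.dom, ∀ v : L.dom, ⟪L.a v, L.a ⟨p.1, h⟩⟫_ℂ = ⟪(v : 𝓗), p.2⟫_ℂ}
  zero_mem' := ⟨L.dom.zero_mem, fun v => by
    rw [show L.a ⟨(0 : 𝓗 × 𝓗).1, L.dom.zero_mem⟩ = 0 from L.a.map_zero]
    simp⟩
  add_mem' := by
    rintro p q ⟨hp, hpv⟩ ⟨hq, hqv⟩
    refine ⟨L.dom.add_mem hp hq, fun v => ?_⟩
    rw [show L.a ⟨(p + q).1, _⟩ = L.a ⟨p.1, hp⟩ + L.a ⟨q.1, hq⟩ from L.a.map_add ⟨_, hp⟩ ⟨_, hq⟩,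
      inner_add_right, hpv, hqv, Prod.snd_add, inner_add_right]
  smul_mem' := by
    rintro z p ⟨hp, hpv⟩
    refine ⟨L.dom.smul_mem z hp, fun v => ?_⟩
    rw [show L.a ⟨(z • p).1, _⟩ = z • L.a ⟨p.1, hp⟩ from L.a.map_smul z ⟨_, hp⟩,
      inner_smul_right, hpv, Prod.smul_snd, inner_smul_right]

variable {L} {u f : 𝓗} {W : 𝓗 →L[ℂ] 𝓗}

theorem mem_kinetic_iff : (u, f) ∈ L.kinetic ↔
    ∃ h : u ∈ L.dom, ∀ v : L.dom, ⟪L.a v, L.a ⟨u, h⟩⟫_ℂ = ⟪(v : 𝓗), f⟫_ℂ :=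
  Iff.rfl

theorem mem_kinetic_iff_exists_c_a_eq : (u, f) ∈ L.kinetic ↔
    ∃ (h : u ∈ L.dom) (h' : L.a ⟨u, h⟩ ∈ L.dom), L.c ⟨L.a ⟨u, h⟩, h'⟩ = f := by
  refine ⟨fun ⟨h, hv⟩ => ⟨h, L.c_max _ _ hv⟩, ?_⟩
  rintro ⟨h, h', rfl⟩
  exact ⟨h, fun v => L.inner_a v ⟨_, h'⟩⟩

theorem kinetic_swap : L.swap.kinetic = addBounded L.kinetic L.β := by
  ext ⟨u, f⟩
  rw [mem_addBounded, mem_kinetic_iff]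
  refine exists_congr fun h => forall_congr' fun v => ?_
  rw [inner_sub_right, eq_sub_iff_add_eq]
  exact Eq.congr_left (L.comm v ⟨u, h⟩)

theorem inner_eq_norm_a_sq {u : L.dom} (h : ((u : 𝓗), f) ∈ L.kinetic) :
    ⟪(u : 𝓗), f⟫_ℂ = ((‖L.a u‖ ^ 2 : ℝ) : ℂ) := by
  rw [← h.2 u, inner_self_eq_norm_sq_to_K]
  simp

theorem norm_a_sq_le {u : L.dom} {S : ℝ} (hW : -S • 1 ≤ W)
    (h : ((u : 𝓗), f) ∈ addBounded L.kinetic W) :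
    ‖L.a u‖ ^ 2 ≤ ‖(u : 𝓗)‖ * ‖f‖ + S * ‖(u : 𝓗)‖ ^ 2 := by
  have hre := congrArg Complex.re (inner_eq_norm_a_sq (mem_addBounded.1 h))
  rw [Complex.ofReal_re, inner_sub_right, Complex.sub_re] at hre
  have hWu := mul_norm_sq_le_re_inner_of_smul_one_le hW (u : 𝓗)
  have huf := (Complex.re_le_norm _).trans (norm_inner_le_norm (𝕜 := ℂ) (u : 𝓗) f)
  linarith

theorem isBoundedBelow_addBounded_of_smul_one_le {d : ℝ} (hd : 0 < d) (hW : d • 1 ≤ W) :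
    IsBoundedBelow (addBounded L.kinetic W) (1 / d) := by
  rintro ⟨u, f⟩ h
  obtain ⟨hu, -⟩ := mem_kinetic_iff.1 (mem_addBounded.1 h)
  rcases (norm_nonneg u).eq_or_lt with hu0 | hu0
  · simp only [← hu0]
    positivity
  · have := norm_a_sq_le (u := ⟨u, hu⟩) (S := -d) (by rwa [neg_neg]) h
    have h' : ‖u‖ * (d * ‖u‖) ≤ ‖u‖ * ‖f‖ := by linarith [sq_nonneg ‖L.a ⟨u, hu⟩‖]
    rw [one_div_mul_eq_div, le_div_iff₀' hd]
    exact le_of_mul_le_mul_left h' hu0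

variable (L) in
/-- The graph of `a` in the Hilbert space `𝓗 ⊕ 𝓗`. -/
def graphA : Submodule ℂ (WithLp 2 (𝓗 × 𝓗)) :=
  (LinearMap.range (L.dom.subtype.prod L.a)).map (WithLp.linearEquiv 2 ℂ (𝓗 × 𝓗)).symm.toLinearMap

variable (L) in
theorem isClosed_graphA : IsClosed (L.graphA : Set (WithLp 2 (𝓗 × 𝓗))) := by
  have : (L.graphA : Set (WithLp 2 (𝓗 × 𝓗))) =
      ⋂ w : L.dom, {p | ⟪L.c w, p.fst⟫_ℂ = ⟪(w : 𝓗), p.snd⟫_ℂ} := by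
    ext p
    rw [mem_iInter]
    constructor
    · rintro ⟨_, ⟨u, rfl⟩, rfl⟩ w
      exact L.inner_c w u
    · intro h
      obtain ⟨hp, hp'⟩ := L.a_max _ _ h
      exact ⟨_, ⟨⟨_, hp⟩, rfl⟩, WithLp.ofLp_injective 2 (Prod.ext rfl hp')⟩
  rw [this]
  exact isClosed_iInter fun w => isClosed_eq
    (continuous_const.inner (WithLp.continuous_fst 2 𝓗 𝓗))
    (continuous_const.inner (WithLp.continuous_snd 2 𝓗 𝓗))

section Complete

variable [CompleteSpace 𝓗]

/-- Von Neumann's argument: decompose `(v, 0)` along the closed graph of `a`. -/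
theorem exists_sub_mem_kinetic (v : 𝓗) : ∃ u, (u, v - u) ∈ L.kinetic := by
  have : CompleteSpace L.graphA := L.isClosed_graphA.completeSpace_coe
  obtain ⟨_, ⟨_, ⟨u, rfl⟩, rfl⟩, z, hz, hadd⟩ :=
    L.graphA.exists_add_mem_mem_orthogonal (WithLp.toLp 2 (v, 0))
  have hfst : v = (u : 𝓗) + z.fst := congrArg WithLp.fst hadd
  have hsnd : 0 = L.a u + z.snd := congrArg WithLp.snd hadd
  refine ⟨u, u.2, fun w => ?_⟩
  have horth : ⟪(w : 𝓗), z.fst⟫_ℂ + ⟪L.a w, z.snd⟫_ℂ = 0 :=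
    (L.graphA.mem_orthogonal z).1 hz _ ⟨_, ⟨w, rfl⟩, rfl⟩
  rw [Subtype.coe_eta, eq_neg_of_add_eq_zero_left hsnd.symm, sub_eq_of_eq_add' hfst,
    inner_neg_right, neg_eq_iff_add_eq_zero, add_comm]
  exact horth

variable (L) in
theorem adjoint_kinetic : L.kinetic.adjoint = L.kinetic := by
  refine adjoint_eq_of_le_of_exists_sub_mem (fun ⟨u, f⟩ h => ?_) exists_sub_mem_kinetic
  rw [Submodule.mem_adjoint_iff]
  intro v g h'
  rw [sub_eq_zero, ← h.2 ⟨v, h'.1⟩, ← inner_conj_symm, ← h'.2 ⟨u, h.1⟩, inner_conj_symm]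

/-- A bounded inverse of `a c` produces the component `c ζ` of `u` orthogonal to the kernel of `a`,
when applied to `φ = a u`. -/
theorem exists_a_c_eq {β₀ : ℝ} (hβ₀ : 0 < β₀) (hβ : β₀ • 1 ≤ L.β) (φ : 𝓗) :
    ∃ (ζ : L.dom) (h : L.c ζ ∈ L.dom), L.a ⟨L.c ζ, h⟩ = φ ∧ β₀ * ‖(ζ : 𝓗)‖ ≤ ‖φ‖ ∧
      √β₀ * ‖L.c ζ‖ ≤ ‖φ‖ := by
  have hK : IsBoundedBelow L.swap.kinetic (1 / β₀) :=
    (kinetic_swap (L := L)) ▸ isBoundedBelow_addBounded_of_smul_one_le hβ₀ hβ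
  obtain ⟨R, hR⟩ := hK.exists_inverse L.swap.adjoint_kinetic
  have hmem : (R φ, φ) ∈ L.swap.kinetic := (hR _ _).2 rfl
  obtain ⟨h, h', hac⟩ := mem_kinetic_iff_exists_c_a_eq.1 hmem
  have hζ : β₀ * ‖R φ‖ ≤ ‖φ‖ := by
    simpa [le_div_iff₀' hβ₀, inv_mul_eq_div] using hK _ hmem
  have hc : ‖L.c ⟨R φ, h⟩‖ ^ 2 ≤ ‖R φ‖ * ‖φ‖ := by
    have := norm_inner_le_norm (𝕜 := ℂ) (R φ) φ
    rwa [inner_eq_norm_a_sq (L := L.swap) (u := ⟨R φ, h⟩) hmem,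
      Complex.norm_of_nonneg (by positivity)] at this
  refine ⟨⟨R φ, h⟩, h', hac, hζ, le_of_sq_le_sq ?_ (norm_nonneg _)⟩
  rw [mul_pow, Real.sq_sqrt hβ₀.le]
  nlinarith [norm_nonneg φ]

end Complete

end LadderPair

namespace LadderPair

variable {𝓗 : Type*} [NormedAddCommGroup 𝓗] [InnerProductSpace ℂ 𝓗] {L : LadderPair 𝓗}
  {W : 𝓗 →L[ℂ] 𝓗} {β₀ d G K Λ : ℝ} {ψ f : 𝓗}

variable (L) in
/-- The bounded operator `W` preserves the domain, and its commutators with `a` and `c` are bounded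
by `G`. -/
def CommBound (W : 𝓗 →L[ℂ] 𝓗) (G : ℝ) : Prop :=
  ∀ u : L.dom, ∃ h : W u ∈ L.dom,
    ‖L.a ⟨W u, h⟩ - W (L.a u)‖ ≤ G * ‖(u : 𝓗)‖ ∧ ‖L.c ⟨W u, h⟩ - W (L.c u)‖ ≤ G * ‖(u : 𝓗)‖

theorem norm_c_le (hd : 0 < d) (hdΛ : d ≤ Λ) (hW : (d - Λ) • 1 ≤ W)
    (hK : IsBoundedBelow (addBounded L.swap.kinetic W) K) (hdK : 1 ≤ d * K) {x : L.dom} {φ : 𝓗}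
    (hx : ((x : 𝓗), φ) ∈ addBounded L.swap.kinetic W) : ‖L.c x‖ ≤ √Λ * K * ‖φ‖ := by
  have hK0 : 0 < K := pos_of_mul_pos_right (by linarith) hd.le
  have hxK : ‖(x : 𝓗)‖ ≤ K * ‖φ‖ := hK _ hx
  have hsq : ‖L.c x‖ ^ 2 ≤ ‖(x : 𝓗)‖ * ‖φ‖ + (Λ - d) * ‖(x : 𝓗)‖ ^ 2 :=
    norm_a_sq_le (L := L.swap) (u := x) (by rwa [neg_sub]) hx
  refine le_of_sq_le_sq ?_ (by positivity)
  calc ‖L.c x‖ ^ 2 ≤ K * ‖φ‖ * ‖φ‖ + (Λ - d) * (K * ‖φ‖) ^ 2 := by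
        refine hsq.trans (add_le_add (by gcongr) ?_)
        exact mul_le_mul_of_nonneg_left (by gcongr) (sub_nonneg.2 hdΛ)
    _ = Λ * (K * ‖φ‖) ^ 2 - (d * K - 1) * (K * ‖φ‖ ^ 2) := by ring
    _ ≤ Λ * (K * ‖φ‖) ^ 2 := sub_le_self _ (mul_nonneg (by linarith) (by positivity))
    _ = (√Λ * K * ‖φ‖) ^ 2 := by rw [mul_assoc, mul_pow √Λ, Real.sq_sqrt (by linarith)]

/-- `a` intertwines `c a + W` with `a c + W` up to the commutator of `a` and `W`. -/
theorem inner_a_self_eq (hW : W.IsSymmetric) {ψ x : L.dom} {φ f : 𝓗} (hφ : L.a ψ = φ)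
    (hψ : ((ψ : 𝓗), f) ∈ addBounded L.kinetic W)
    (hx : ((x : 𝓗), φ) ∈ addBounded L.swap.kinetic W) (hWx : W x ∈ L.dom) :
    ⟪φ, φ⟫_ℂ = ⟪f, L.c x⟫_ℂ + ⟪(ψ : 𝓗), L.c ⟨W x, hWx⟩ - W (L.c x)⟫_ℂ := by
  subst hφ
  obtain ⟨_, hφd, hcφ⟩ := mem_kinetic_iff_exists_c_a_eq.1 (mem_addBounded.1 hψ)
  obtain ⟨_, hvx⟩ := mem_kinetic_iff.1 (mem_addBounded.1 hx)
  have hca : ⟪L.c ⟨L.a ψ, hφd⟩, L.c x⟫_ℂ = ⟪L.a ψ, L.a ψ⟫_ℂ - ⟪L.a ψ, W x⟫_ℂ :=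
    (hvx ⟨L.a ψ, hφd⟩).trans (inner_sub_right _ _ _)
  have hψW : ⟪L.a ψ, W x⟫_ℂ = ⟪(ψ : 𝓗), L.c ⟨W x, hWx⟩⟫_ℂ := L.inner_a ψ ⟨W x, hWx⟩
  rw [show L.c ⟨L.a ψ, hφd⟩ = f - W ψ from hcφ, inner_sub_left,
    show ⟪W ψ, L.c x⟫_ℂ = ⟪(ψ : 𝓗), W (L.c x)⟫_ℂ from hW _ _] at hca
  rw [inner_sub_right]
  linear_combination -hca + hψW

theorem norm_le_of_a_eq_zero (hG : 0 ≤ G) (hW : d • 1 ≤ -W) (hWG : L.CommBound W G)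
    {ψ₀ ζ : L.dom} (hψ₀ : L.a ψ₀ = 0)
    (hψ : ((ψ₀ : 𝓗) + L.c ζ, f) ∈ addBounded L.kinetic W) :
    d * ‖(ψ₀ : 𝓗)‖ ≤ ‖f‖ + G * ‖(ζ : 𝓗)‖ := by
  have hWs : (-W).IsSymmetric := isSymmetric_of_smul_one_le hW
  obtain ⟨hWψ, ha, -⟩ := hWG ψ₀
  rw [hψ₀, map_zero, sub_zero] at ha
  obtain ⟨_, hkin⟩ := mem_kinetic_iff.1 (mem_addBounded.1 hψ)
  have hf : ⟪(ψ₀ : 𝓗), f⟫_ℂ = ⟪(ψ₀ : 𝓗), W ψ₀⟫_ℂ + ⟪L.a ⟨W ψ₀, hWψ⟩, (ζ : 𝓗)⟫_ℂ := by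
    have h0 : ⟪(ψ₀ : 𝓗), f⟫_ℂ - ⟪(ψ₀ : 𝓗), W (ψ₀ + L.c ζ)⟫_ℂ = 0 := by
      rw [← inner_sub_right]
      exact (hkin ψ₀).symm.trans (by rw [hψ₀, inner_zero_left])
    have hWc : ⟪(ψ₀ : 𝓗), W (L.c ζ)⟫_ℂ = ⟪W ψ₀, L.c ζ⟫_ℂ := by
      simpa using (hWs ψ₀ (L.c ζ)).symm
    rw [sub_eq_zero.1 h0, map_add, inner_add_right, hWc, L.inner_a]
  have hsq : ‖(ψ₀ : 𝓗)‖ * (d * ‖(ψ₀ : 𝓗)‖) ≤ ‖(ψ₀ : 𝓗)‖ * (‖f‖ + G * ‖(ζ : 𝓗)‖) := by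
    calc ‖(ψ₀ : 𝓗)‖ * (d * ‖(ψ₀ : 𝓗)‖) = d * ‖(ψ₀ : 𝓗)‖ ^ 2 := by ring
      _ ≤ (⟪(ψ₀ : 𝓗), (-W) ψ₀⟫_ℂ).re := mul_norm_sq_le_re_inner_of_smul_one_le hW _
      _ = (⟪L.a ⟨W ψ₀, hWψ⟩, (ζ : 𝓗)⟫_ℂ - ⟪(ψ₀ : 𝓗), f⟫_ℂ).re := by
        rw [hf, neg_apply, inner_neg_right]
        congr 1
        ring
      _ ≤ ‖L.a ⟨W ψ₀, hWψ⟩‖ * ‖(ζ : 𝓗)‖ + ‖(ψ₀ : 𝓗)‖ * ‖f‖ :=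
        (Complex.re_le_norm _).trans
          (norm_sub_le_of_le (norm_inner_le_norm _ _) (norm_inner_le_norm _ _))
      _ ≤ G * ‖(ψ₀ : 𝓗)‖ * ‖(ζ : 𝓗)‖ + ‖(ψ₀ : 𝓗)‖ * ‖f‖ := by gcongr
      _ = _ := by ring
  rcases (norm_nonneg (ψ₀ : 𝓗)).eq_or_lt with h0 | h0
  · rw [← h0, mul_zero]
    positivity
  · exact le_of_mul_le_mul_left hsq h0

variable [CompleteSpace 𝓗]

theorem norm_a_le (hd : 0 < d) (hdΛ : d ≤ Λ) (hW : (d - Λ) • 1 ≤ W) (hG : 0 ≤ G)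
    (hWG : L.CommBound W G) (hK : IsBoundedBelow (addBounded L.swap.kinetic W) K)
    (hdK : 1 ≤ d * K) {ψ : L.dom} (hψ : ((ψ : 𝓗), f) ∈ addBounded L.kinetic W) :
    ‖L.a ψ‖ ≤ √Λ * K * ‖f‖ + G * K * ‖(ψ : 𝓗)‖ := by
  have hK0 : 0 < K := pos_of_mul_pos_right (by linarith) hd.le
  have hWs : W.IsSymmetric := isSymmetric_of_smul_one_le hW
  obtain ⟨R, hR⟩ := hK.exists_inverse (adjoint_addBounded L.swap.adjoint_kinetic hWs)
  set φ := L.a ψ with hφ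
  have hRφ : (R φ, φ) ∈ addBounded L.swap.kinetic W := (hR _ _).2 rfl
  obtain ⟨hx, -⟩ := mem_kinetic_iff.1 (mem_addBounded.1 hRφ)
  let x : L.dom := ⟨R φ, hx⟩
  have hcx : ‖L.c x‖ ≤ √Λ * K * ‖φ‖ := norm_c_le hd hdΛ hW hK hdK hRφ
  have hxφ : ‖(x : 𝓗)‖ ≤ K * ‖φ‖ := hK _ hRφ
  obtain ⟨hWx, -, hcomm⟩ := hWG x
  have hsq : ‖φ‖ * ‖φ‖ ≤ ‖φ‖ * (√Λ * K * ‖f‖ + G * K * ‖(ψ : 𝓗)‖) := by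
    calc ‖φ‖ * ‖φ‖ = ‖⟪φ, φ⟫_ℂ‖ := by
          simp [inner_self_eq_norm_sq_to_K, sq]
      _ ≤ ‖f‖ * ‖L.c x‖ + ‖(ψ : 𝓗)‖ * ‖L.c ⟨W x, hWx⟩ - W (L.c x)‖ := by
          rw [inner_a_self_eq hWs hφ.symm hψ hRφ hWx]
          exact norm_add_le_of_le (norm_inner_le_norm _ _) (norm_inner_le_norm _ _)
      _ ≤ ‖f‖ * (√Λ * K * ‖φ‖) + ‖(ψ : 𝓗)‖ * (G * (K * ‖φ‖)) := by
          gcongr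
          exact hcomm.trans (by gcongr)
      _ = _ := by ring
  rcases (norm_nonneg φ).eq_or_lt with h0 | h0
  · rw [← h0]
    positivity
  · exact le_of_mul_le_mul_left hsq h0

theorem mul_norm_le (hβ₀ : 0 < β₀) (hβ : β₀ • 1 ≤ L.β) (hd : 0 ≤ d) (hG : 0 ≤ G)
    (hGd : 4 * G ≤ d * √β₀) (hW : d • 1 ≤ -W) (hWG : L.CommBound W G) {ψ : L.dom}
    (hψ : ((ψ : 𝓗), f) ∈ addBounded L.kinetic W) :
    4 * √β₀ * (d * ‖(ψ : 𝓗)‖) ≤ 4 * √β₀ * ‖f‖ + 5 * (d * ‖L.a ψ‖) := by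
  obtain ⟨ζ, hcζ, hacζ, hζ, hcζ'⟩ := exists_a_c_eq hβ₀ hβ (L.a ψ)
  set ψ₀ : L.dom := ψ - ⟨L.c ζ, hcζ⟩
  have hdecomp : (ψ : 𝓗) = ψ₀ + L.c ζ := by simp [ψ₀]
  have hψ₀ : d * ‖(ψ₀ : 𝓗)‖ ≤ ‖f‖ + G * ‖(ζ : 𝓗)‖ :=
    norm_le_of_a_eq_zero hG hW hWG (by rw [map_sub, hacζ, sub_self]) (hdecomp ▸ hψ)
  have hGζ : 4 * √β₀ * (G * ‖(ζ : 𝓗)‖) ≤ d * ‖L.a ψ‖ := by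
    calc 4 * √β₀ * (G * ‖(ζ : 𝓗)‖) = 4 * G * (√β₀ * ‖(ζ : 𝓗)‖) := by ring
      _ ≤ d * √β₀ * (√β₀ * ‖(ζ : 𝓗)‖) := by gcongr
      _ = d * (√β₀ * √β₀ * ‖(ζ : 𝓗)‖) := by ring
      _ ≤ d * ‖L.a ψ‖ := by
        rw [Real.mul_self_sqrt hβ₀.le]
        gcongr
  calc 4 * √β₀ * (d * ‖(ψ : 𝓗)‖) ≤ 4 * √β₀ * (d * (‖(ψ₀ : 𝓗)‖ + ‖L.c ζ‖)) := by
        rw [hdecomp]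
        gcongr
        exact norm_add_le _ _
    _ = 4 * √β₀ * (d * ‖(ψ₀ : 𝓗)‖) + 4 * (d * (√β₀ * ‖L.c ζ‖)) := by ring
    _ ≤ 4 * √β₀ * (‖f‖ + G * ‖(ζ : 𝓗)‖) + 4 * (d * ‖L.a ψ‖) := by gcongr
    _ ≤ _ := by linarith

theorem isBoundedBelow_of_add {M s : ℝ} (hβ₀ : 0 < β₀) (hβ : β₀ • 1 ≤ L.β) (hd : 0 < d)
    (hdΛ : d ≤ Λ) (hs : √Λ ≤ s * √β₀) (hG : 0 ≤ G) (hM : 1 ≤ M) (hMG : 4 * (M * G) ≤ d * √β₀)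
    (hW : d • 1 ≤ -W) (hWΛ : (d - Λ) • 1 ≤ W) (hWG : L.CommBound W G)
    (hK : IsBoundedBelow (addBounded L.kinetic (W + L.β)) (M / d)) :
    IsBoundedBelow (addBounded L.kinetic W) ((2 + 2 * s * M) / d) := by
  rintro ⟨ψ, f⟩ hψ
  obtain ⟨hψd, -⟩ := mem_kinetic_iff.1 (mem_addBounded.1 hψ)
  rw [add_comm, ← addBounded_addBounded, ← kinetic_swap] at hK
  have hr : 0 < √β₀ := Real.sqrt_pos.2 hβ₀
  have hGG : G ≤ M * G := le_mul_of_one_le_left hG hM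
  have hψb := mul_norm_le hβ₀ hβ hd.le hG (by linarith) hW hWG (ψ := ⟨ψ, hψd⟩) hψ
  have hφ : d * ‖L.a ⟨ψ, hψd⟩‖ ≤ √β₀ * (s * M * ‖f‖ + d * ‖ψ‖ / 4) := by
    calc d * ‖L.a ⟨ψ, hψd⟩‖ ≤ d * (√Λ * (M / d) * ‖f‖ + G * (M / d) * ‖ψ‖) := by
          gcongr
          exact norm_a_le hd hdΛ hWΛ hG hWG hK (by rwa [mul_div_cancel₀ _ hd.ne']) hψ
      _ = √Λ * (M * ‖f‖) + M * G * ‖ψ‖ := by field_simp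
      _ ≤ s * √β₀ * (M * ‖f‖) + d * √β₀ / 4 * ‖ψ‖ := by
          gcongr
          linarith
      _ = _ := by ring
  have hcancel : √β₀ * (11 / 4 * (d * ‖ψ‖)) ≤ √β₀ * ((4 + 5 * (s * M)) * ‖f‖) := by
    change 4 * √β₀ * (d * ‖ψ‖) ≤ _ at hψb
    linarith
  have hsM : 0 ≤ s * M * ‖f‖ := by
    have : 0 ≤ s := nonneg_of_mul_nonneg_left ((Real.sqrt_nonneg Λ).trans hs) hr
    positivity
  rw [div_mul_eq_mul_div, le_div_iff₀ hd]
  linarith [le_of_mul_le_mul_left hcancel hr, norm_nonneg f]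

/-- The constants in the lower bounds obtained by going down `k` Landau levels. -/
def resolventConst (s : ℝ) : ℕ → ℝ
  | 0 => 1
  | k + 1 => 2 + 2 * s * resolventConst s k

theorem one_le_resolventConst {s : ℝ} (hs : 0 ≤ s) : ∀ k, 1 ≤ resolventConst s k
  | 0 => le_rfl
  | k + 1 => by
    have : 0 ≤ s * resolventConst s k := mul_nonneg hs (by linarith [one_le_resolventConst hs k])
    rw [resolventConst]
    linarith

theorem resolventConst_le_succ {s : ℝ} (hs : 0 ≤ s) :
    ∀ k, resolventConst s k ≤ resolventConst s (k + 1)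
  | 0 => one_le_resolventConst hs 1
  | k + 1 => by
    have := mul_le_mul_of_nonneg_left (resolventConst_le_succ hs k) hs
    rw [resolventConst, resolventConst]
    linarith

theorem isBoundedBelow_of_ladder {s : ℝ} (hβ₀ : 0 < β₀) (hβ : β₀ • 1 ≤ L.β) (hd : 0 < d)
    (hdΛ : d ≤ Λ) (hs : √Λ ≤ s * √β₀) (hG : 0 ≤ G) (N : ℕ)
    (hNG : 4 * (resolventConst s N * G) ≤ d * √β₀) (W : 𝓗 →L[ℂ] 𝓗)
    (hWG : ∀ k < N, L.CommBound (W + k • L.β) G) (hW : ∀ k < N, d • 1 ≤ -(W + k • L.β))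
    (hWΛ : ∀ k < N, (d - Λ) • 1 ≤ W + k • L.β) (hWN : d • 1 ≤ W + N • L.β) :
    IsBoundedBelow (addBounded L.kinetic W) (resolventConst s N / d) := by
  have hs0 : 0 ≤ s :=
    nonneg_of_mul_nonneg_left ((Real.sqrt_nonneg Λ).trans hs) (Real.sqrt_pos.2 hβ₀)
  induction N generalizing W with
  | zero => exact isBoundedBelow_addBounded_of_smul_one_le hd (by simpa using hWN)
  | succ N ih =>
    have hshift (k : ℕ) : W + L.β + k • L.β = W + (k + 1) • L.β := by rw [succ_nsmul']; abel
    have hMG : 4 * (resolventConst s N * G) ≤ d * √β₀ := by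
      have := mul_le_mul_of_nonneg_right (resolventConst_le_succ hs0 N) hG
      linarith
    have hstep := ih hMG (W + L.β) (fun k hk => hshift k ▸ hWG _ (by lia))
      (fun k hk => hshift k ▸ hW _ (by lia)) (fun k hk => hshift k ▸ hWΛ _ (by lia))
      (hshift N ▸ hWN)
    have hzero : W + 0 • L.β = W := by rw [zero_smul, add_zero]
    exact isBoundedBelow_of_add hβ₀ hβ hd hdΛ hs hG (one_le_resolventConst hs0 N) hMG
      (hzero ▸ hW 0 N.succ_pos) (hzero ▸ hWΛ 0 N.succ_pos) (hzero ▸ hWG 0 N.succ_pos) hstep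

end LadderPair

section Mollifier

variable {G F : Type*} [NormedAddCommGroup G] [NormedSpace ℝ G] [MeasurableSpace G] [BorelSpace G]
  {μ : Measure G}

theorem measurable_ofReal_normed [HasContDiffBump G] (ρ : ContDiffBump (0 : G)) :
    Measurable fun y => ENNReal.ofReal (ρ.normed μ y) :=
  ρ.continuous_normed.measurable.ennreal_ofReal

variable [FiniteDimensional ℝ G] [μ.IsAddHaarMeasure] [NormedAddCommGroup F] {p : NNReal}

theorem tendsto_eLpNorm_translate_sub (hp : 1 ≤ p) {f : G → F} (hf : MemLp f p μ) :
    Tendsto (fun y => eLpNorm (fun x => f (x - y) - f x) p μ) (𝓝 0) (𝓝 0) := by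
  have : Fact (1 ≤ (p : ENNReal)) := ⟨by exact_mod_cast hp⟩
  have := FiniteDimensional.proper_real G
  let g : C(G, C(G, G)) := (ContinuousMap.mk (fun q : G × G => q.2 - q.1) (by fun_prop)).curry
  have hg : ∀ y, MeasurePreserving (g y) μ μ := fun y => measurePreserving_sub_right μ y
  have hcont := (continuous_const (y := hf.toLp f)).compMeasurePreservingLp g.continuous hg
    ENNReal.coe_ne_top
  refine (tendsto_iff_edist_tendsto_0.1 (hcont.tendsto 0)).congr fun y => ?_
  rw [Lp.edist_def]
  refine eLpNorm_congr_ae ?_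
  filter_upwards [Lp.coeFn_compMeasurePreserving (hf.toLp f) (hg y),
    Lp.coeFn_compMeasurePreserving (hf.toLp f) (hg 0), hf.coeFn_toLp,
    (hg y).quasiMeasurePreserving.ae_eq_comp hf.coeFn_toLp] with x hy h0 hx hxy
  have hx0 : g 0 x = x := sub_zero x
  rw [Pi.sub_apply, hy, h0, hxy, Function.comp_apply, Function.comp_apply, hx0, hx]
  rfl

theorem lintegral_ofReal_normed [HasContDiffBump G] (ρ : ContDiffBump (0 : G)) :
    ∫⁻ y, ENNReal.ofReal (ρ.normed μ y) ∂μ = 1 := by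
  rw [← ofReal_integral_eq_lintegral_ofReal ρ.integrable_normed
    (Eventually.of_forall ρ.nonneg_normed), ρ.integral_normed, ENNReal.ofReal_one]

variable [HasContDiffBump G] [NormedSpace ℝ F]

-- Jensen's inequality for the probability measure `ρ.normed μ • μ`.
theorem enorm_integral_normed_smul_rpow_le (hp : 1 ≤ p) {h : G → F} (hh : StronglyMeasurable h)
    (ρ : ContDiffBump (0 : G)) :
    ‖∫ y, ρ.normed μ y • h y ∂μ‖ₑ ^ (p : ℝ) ≤
      ∫⁻ y, ENNReal.ofReal (ρ.normed μ y) * ‖h y‖ₑ ^ (p : ℝ) ∂μ := by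
  set ν : Measure G := μ.withDensity fun y => ENNReal.ofReal (ρ.normed μ y) with hν
  have : IsProbabilityMeasure ν := ⟨by
    rw [hν, withDensity_apply _ MeasurableSet.univ, Measure.restrict_univ,
      lintegral_ofReal_normed]⟩
  have hint : ∫ y, ρ.normed μ y • h y ∂μ = ∫ y, h y ∂ν := by
    rw [hν, integral_withDensity_eq_integral_toReal_smul (measurable_ofReal_normed ρ)
      (Eventually.of_forall fun _ => ENNReal.ofReal_lt_top)]
    simp only [ENNReal.toReal_ofReal (ρ.nonneg_normed _)]
  have hp0 : p ≠ 0 := (one_pos.trans_le hp).ne'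
  calc ‖∫ y, ρ.normed μ y • h y ∂μ‖ₑ ^ (p : ℝ)
      ≤ eLpNorm h 1 ν ^ (p : ℝ) := by
        rw [hint, eLpNorm_one_eq_lintegral_enorm]
        gcongr
        exact enorm_integral_le_lintegral_enorm _
    _ ≤ eLpNorm h p ν ^ (p : ℝ) := by
        gcongr
        exact eLpNorm_le_eLpNorm_of_exponent_le (by exact_mod_cast hp) hh.aestronglyMeasurable
    _ = ∫⁻ y, ‖h y‖ₑ ^ (p : ℝ) ∂ν := eLpNorm_nnreal_pow_eq_lintegral hp0
    _ = _ := lintegral_withDensity_eq_lintegral_mul _ (measurable_ofReal_normed ρ)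
        (hh.enorm.pow_const _)

variable [CompleteSpace F]

theorem convolution_normed_sub_eq_integral {f : G → F} (hf : LocallyIntegrable f μ)
    (ρ : ContDiffBump (0 : G)) (x : G) :
    (ρ.normed μ ⋆[ContinuousLinearMap.lsmul ℝ ℝ, μ] f) x - f x =
      ∫ y, ρ.normed μ y • (f (x - y) - f x) ∂μ := by
  have hconv : Integrable (fun y => ρ.normed μ y • f (x - y)) μ :=
    ρ.hasCompactSupport_normed.convolutionExists_left (ContinuousLinearMap.lsmul ℝ ℝ)
      ρ.continuous_normed hf x
  simp_rw [smul_sub]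
  rw [integral_sub hconv (ρ.integrable_normed.smul_const _), integral_smul_const,
    ρ.integral_normed, one_smul]
  rfl

theorem eLpNorm_convolution_normed_sub_le (hp : 1 ≤ p) {f : G → F} (hf : LocallyIntegrable f μ)
    (hfm : StronglyMeasurable f) (ρ : ContDiffBump (0 : G)) {ε : ENNReal}
    (hε : ∀ y ∈ Metric.ball (0 : G) ρ.rOut, eLpNorm (fun x => f (x - y) - f x) p μ ≤ ε) :
    eLpNorm (ρ.normed μ ⋆[ContinuousLinearMap.lsmul ℝ ℝ, μ] f - f) p μ ≤ ε := by
  have hp0 : p ≠ 0 := (one_pos.trans_le hp).ne'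
  have hp' : (0 : ℝ) < p := NNReal.coe_pos.2 (one_pos.trans_le hp)
  have hdiff : Measurable fun q : G × G => ‖f (q.1 - q.2) - f q.1‖ₑ ^ (p : ℝ) :=
    ((hfm.comp_measurable (measurable_fst.sub measurable_snd)).sub
      (hfm.comp_measurable measurable_fst)).enorm.pow_const _
  rw [← ENNReal.rpow_le_rpow_iff hp', eLpNorm_nnreal_pow_eq_lintegral hp0]
  calc _ ≤ ∫⁻ x, ∫⁻ y, ENNReal.ofReal (ρ.normed μ y) * ‖f (x - y) - f x‖ₑ ^ (p : ℝ) ∂μ ∂μ := by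
        refine lintegral_mono fun x => ?_
        rw [Pi.sub_apply, convolution_normed_sub_eq_integral hf]
        exact enorm_integral_normed_smul_rpow_le hp ((hfm.comp_measurable
          (measurable_const.sub measurable_id)).sub stronglyMeasurable_const) ρ
    _ = ∫⁻ y, ∫⁻ x, ENNReal.ofReal (ρ.normed μ y) * ‖f (x - y) - f x‖ₑ ^ (p : ℝ) ∂μ ∂μ :=
        lintegral_lintegral_swap
          (((measurable_ofReal_normed ρ).comp measurable_snd).mul hdiff).aemeasurable
    _ ≤ ∫⁻ y, ENNReal.ofReal (ρ.normed μ y) * ε ^ (p : ℝ) ∂μ := by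
        refine lintegral_mono fun y => ?_
        rw [lintegral_const_mul' _ _ ENNReal.ofReal_ne_top]
        by_cases hy : y ∈ Metric.ball (0 : G) ρ.rOut
        · rw [← eLpNorm_nnreal_pow_eq_lintegral (f := fun x => f (x - y) - f x) hp0]
          gcongr
          exact hε y hy
        · rw [← ρ.support_normed_eq (μ := μ), Function.notMem_support] at hy
          simp only [hy, ENNReal.ofReal_zero, zero_mul, le_refl]
    _ = ε ^ (p : ℝ) := by
        rw [lintegral_mul_const _ (measurable_ofReal_normed ρ), lintegral_ofReal_normed, one_mul]

theorem tendsto_eLpNorm_convolution_normed_sub (hp : 1 ≤ p) {f : G → F} (hf : MemLp f p μ)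
    {ι : Type*} {l : Filter ι} {ρ : ι → ContDiffBump (0 : G)}
    (hρ : Tendsto (fun i => (ρ i).rOut) l (𝓝 0)) :
    Tendsto (fun i => eLpNorm
      ((ρ i).normed μ ⋆[ContinuousLinearMap.lsmul ℝ ℝ, μ] f - f) p μ) l (𝓝 0) := by
  have := FiniteDimensional.proper_real G
  set g := hf.1.mk f
  have hfg : f =ᵐ[μ] g := hf.1.ae_eq_mk
  have hg : MemLp g p μ := hf.ae_eq hfg
  rw [ENNReal.tendsto_nhds_zero]
  intro ε hε
  obtain ⟨δ, hδ, hball⟩ := Metric.eventually_nhds_iff.1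
    (ENNReal.tendsto_nhds_zero.1 (tendsto_eLpNorm_translate_sub hp hg) ε hε)
  filter_upwards [hρ.eventually (gt_mem_nhds hδ)] with i hi
  refine (eLpNorm_congr_ae ?_).trans_le (eLpNorm_convolution_normed_sub_le hp
    (hg.locallyIntegrable (by exact_mod_cast hp)) hf.1.stronglyMeasurable_mk (ρ i)
    fun y hy => hball (lt_trans hy hi))
  rw [convolution_congr _ (ae_eq_refl _) hfg]
  exact EventuallyEq.rfl.sub hfg

end Mollifier

section Divergence

variable {n : ℕ} {F : Type*} [NormedAddCommGroup F] [NormedSpace ℝ F]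

theorem integral_divergence_pi_eq_zero {f : Fin (n + 1) → (Fin (n + 1) → ℝ) → F}
    (hd : ∀ i, Differentiable ℝ (f i)) (hc : ∀ i, HasCompactSupport (f i))
    (hi : Integrable fun x => ∑ i, fderiv ℝ (f i) x (Pi.single i 1)) :
    ∫ x, ∑ i, fderiv ℝ (f i) x (Pi.single i 1) = 0 := by
  obtain ⟨r, hr, hsub⟩ := (isCompact_iUnion fun i => (hc i).isCompact).isBounded.subset_ball_lt 0 0
  have hzero : ∀ i x, r ≤ ‖x‖ → x ∉ tsupport (f i) := fun i x hx hmem =>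
    (mem_ball_zero_iff.1 (hsub (mem_iUnion_of_mem i hmem))).not_ge hx
  have hface : ∀ (i : Fin (n + 1)) (t : ℝ) (y : Fin n → ℝ), |t| = r →
      f i (i.insertNth t y) = 0 := fun i t y ht =>
    image_eq_zero_of_notMem_tsupport (hzero i _ (by
      simpa only [Fin.insertNth_apply_same, Real.norm_eq_abs, ht] using
        norm_le_pi_norm (i.insertNth t y : Fin (n + 1) → ℝ) i))
  rw [← setIntegral_eq_integral_of_forall_compl_eq_zero
      (s := Icc (fun _ => -r) (fun _ => r : Fin (n + 1) → ℝ)),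
    integral_divergence_of_hasFDerivAt_off_countable' _ _ (fun _ => by linarith) f
      (fun i => fderiv ℝ (f i)) ∅ countable_empty (fun i => (hd i).continuous.continuousOn)
      (fun x _ i => (hd i x).hasFDerivAt) hi.integrableOn]
  · simp only [hface _ r _ (abs_of_pos hr), hface _ (-r) _ ((abs_neg r).trans (abs_of_pos hr)),
      integral_zero, sub_self, Finset.sum_const_zero]
  · intro x hx
    refine Finset.sum_eq_zero fun i _ => ?_
    rw [fderiv_of_notMem_tsupport ℝ (hzero i x ?_), zero_apply]
    by_contra! hlt
    exact hx (by
      rw [← pi_univ_Icc]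
      exact fun j _ => abs_le.1 ((norm_le_pi_norm x j).trans hlt.le))

theorem integral_divergence_eq_zero {f : Fin (n + 1) → EuclideanSpace ℝ (Fin (n + 1)) → F}
    (hd : ∀ i, Differentiable ℝ (f i)) (hc : ∀ i, HasCompactSupport (f i))
    (hi : Integrable fun x => ∑ i, fderiv ℝ (f i) x (EuclideanSpace.single i 1)) :
    ∫ x, ∑ i, fderiv ℝ (f i) x (EuclideanSpace.single i 1) = 0 := by
  let T := (EuclideanSpace.equiv (Fin (n + 1)) ℝ).symm
  have hmp : MeasurePreserving T := PiLp.volume_preserving_toLp (Fin (n + 1))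
  have hme : MeasurableEmbedding T := T.toHomeomorph.measurableEmbedding
  have hdiv : ∀ y, ∑ i, fderiv ℝ (f i) (T y) (EuclideanSpace.single i 1) =
      ∑ i, fderiv ℝ (f i ∘ T) y (Pi.single i 1) := fun y =>
    Finset.sum_congr rfl fun i _ => by rw [T.comp_right_fderiv]; rfl
  rw [← hmp.integral_comp hme]
  rw [← hmp.integrable_comp_emb hme] at hi
  simp only [Function.comp_def, hdiv] at hi ⊢
  exact integral_divergence_pi_eq_zero (fun i => (hd i).comp T.differentiable)
    (fun i => (hc i).comp_homeomorph T.toHomeomorph) hi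

end Divergence

section Multiplication

theorem coeFn_potential (V : Plane →ᵇ ℝ) (u : L2) :
    potential V u =ᵐ[volume] fun x => (V x : ℂ) * u x :=
  (memLp_potential V u).coeFn_toLp

theorem norm_potential_apply_le (V : Plane →ᵇ ℝ) (u : L2) : ‖potential V u‖ ≤ ‖V‖ * ‖u‖ := by
  refine Lp.norm_le_mul_norm_of_ae_le_mul ?_
  filter_upwards [coeFn_potential V u] with x hx
  rw [hx, norm_mul, Complex.norm_real]
  exact mul_le_mul_of_nonneg_right (V.norm_coe_le_norm x) (norm_nonneg _)

/-- `potential V` as a bounded operator, depending linearly on `V`. -/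
def potentialL : (Plane →ᵇ ℝ) →ₗ[ℝ] L2 →L[ℂ] L2 where
  toFun V := (potential V).mkContinuous ‖V‖ (norm_potential_apply_le V)
  map_add' V W := by
    ext1 u
    refine Lp.ext ?_
    filter_upwards [coeFn_potential (V + W) u, coeFn_potential V u, coeFn_potential W u,
      Lp.coeFn_add (potential V u) (potential W u)] with x hVW hV hW hadd
    change potential (V + W) u x = (potential V u + potential W u : L2) x
    rw [hVW, hadd, Pi.add_apply, hV, hW, BoundedContinuousFunction.add_apply, Complex.ofReal_add,
      add_mul]
  map_smul' t V := by
    ext1 u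
    refine Lp.ext ?_
    filter_upwards [coeFn_potential (t • V) u, coeFn_potential V u,
      Lp.coeFn_smul t (potential V u)] with x htV hV hsmul
    change potential (t • V) u x = (t • potential V u : L2) x
    rw [htV, hsmul, Pi.smul_apply, hV, BoundedContinuousFunction.smul_apply, smul_eq_mul,
      Complex.ofReal_mul, mul_assoc, Complex.real_smul]

variable {V W : Plane →ᵇ ℝ}

theorem potentialL_apply (u : L2) : potentialL V u = potential V u := rfl

theorem potentialL_const_apply (d : ℝ) (u : L2) :
    potentialL (BoundedContinuousFunction.const Plane d) u = (d : ℂ) • u := by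
  refine Lp.ext ?_
  filter_upwards [coeFn_potential (BoundedContinuousFunction.const Plane d) u,
    Lp.coeFn_smul (d : ℂ) u] with x hx hsmul
  rw [potentialL_apply, hx, hsmul, Pi.smul_apply, smul_eq_mul,
    BoundedContinuousFunction.const_apply]

theorem potentialL_const (d : ℝ) :
    potentialL (BoundedContinuousFunction.const Plane d) = d • 1 := by
  ext1 u
  exact potentialL_const_apply d u

theorem potentialL_nonneg (hV : 0 ≤ V) : 0 ≤ potentialL V := by
  rw [ContinuousLinearMap.nonneg_iff_isPositive]
  refine ⟨fun u v => ?_, fun u => ?_⟩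
  · rw [L2.inner_def, L2.inner_def]
    refine integral_congr_ae ?_
    filter_upwards [coeFn_potential V u, coeFn_potential V v] with x hu hv
    simp only [ContinuousLinearMap.coe_coe, potentialL_apply, hu, hv, RCLike.inner_apply, map_mul,
      Complex.conj_ofReal]
    ring
  · rw [ContinuousLinearMap.reApplyInnerSelf_apply, L2.inner_def,
      ← integral_re (L2.integrable_inner _ _)]
    refine integral_nonneg_of_ae ?_
    filter_upwards [coeFn_potential V u] with x hx
    simp only [potentialL_apply, hx, RCLike.inner_apply, map_mul, Complex.conj_ofReal]
    rw [mul_left_comm, Complex.mul_conj, ← Complex.ofReal_mul]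
    exact mul_nonneg (hV x) (Complex.normSq_nonneg _)

theorem potentialL_mono (h : V ≤ W) : potentialL V ≤ potentialL W := by
  rw [← sub_nonneg, ← map_sub]
  exact potentialL_nonneg (sub_nonneg.2 h)

theorem smul_one_le_potentialL {d : ℝ} (h : ∀ x, d ≤ V x) : d • 1 ≤ potentialL V :=
  potentialL_const d ▸ potentialL_mono h

theorem inner_potentialL_left (u v : L2) : ⟪potentialL V u, v⟫_ℂ = ⟪u, potentialL V v⟫_ℂ :=
  isSymmetric_of_smul_one_le
    (smul_one_le_potentialL fun x => (abs_le.1 (V.norm_coe_le_norm x)).1) u v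

end Multiplication

section FirstOrder

/-- The operator `p₁ + σ p₂`, where `p = -i∇`. -/
def dbar (σ : ℂ) (f : Plane → ℂ) (x : Plane) : ℂ :=
  -Complex.I * (fderiv ℝ f x (e 0) + σ * fderiv ℝ f x (e 1))

/-- The multiplication part `A₁ + σ A₂` of the operator `π₁ + σ π₂`, where `π = p - A`. -/
def ladderPotential (A : C(Plane, Plane)) (σ : ℂ) (x : Plane) : ℂ := A x 0 + σ * A x 1

/-- The operator `π₁ + σ π₂`, where `π = p - A`. It annihilates or creates according to
whether `σ = i` or `σ = -i`. -/
def ladderFun (A : C(Plane, Plane)) (σ : ℂ) (f : Plane → ℂ) (x : Plane) : ℂ :=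
  dbar σ f x - ladderPotential A σ x * f x

variable {A : C(Plane, Plane)} {σ : ℂ} {f g : Plane → ℂ} {x : Plane}

theorem dbar_mul (hf : DifferentiableAt ℝ f x) (hg : DifferentiableAt ℝ g x) :
    dbar σ (f * g) x = f x * dbar σ g x + g x * dbar σ f x := by
  simp only [dbar, fderiv_mul hf hg, add_apply, smul_apply, smul_eq_mul]
  ring

theorem ladderFun_mul (hf : DifferentiableAt ℝ f x) (hg : DifferentiableAt ℝ g x) :
    ladderFun A σ (f * g) x = f x * ladderFun A σ g x + dbar σ f x * g x := by
  rw [ladderFun, dbar_mul hf hg, ladderFun, Pi.mul_apply]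
  ring

theorem dbar_conj (hf : DifferentiableAt ℝ f x) :
    dbar σ (fun y => conj (f y)) x = -conj (dbar (conj σ) f x) := by
  have h : fderiv ℝ (fun y => conj (f y)) x = (Complex.conjCLE : ℂ →L[ℝ] ℂ).comp (fderiv ℝ f x) :=
    ((Complex.conjCLE : ℂ →L[ℝ] ℂ).hasFDerivAt.comp x hf.hasFDerivAt).fderiv
  simp only [dbar, h, ContinuousLinearMap.comp_apply, ContinuousLinearEquiv.coe_coe,
    Complex.conjCLE_apply, map_mul, map_neg, map_add, Complex.conj_I, Complex.conj_conj]
  ring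

theorem conj_ladderPotential : conj (ladderPotential A (conj σ) x) = ladderPotential A σ x := by
  simp only [ladderPotential, map_add, map_mul, Complex.conj_conj, Complex.conj_ofReal]

theorem norm_dbar_le (σ : ℂ) (f : Plane → ℂ) (x : Plane) :
    ‖dbar σ f x‖ ≤ (1 + ‖σ‖) * ‖fderiv ℝ f x‖ := by
  have he (j : Fin 2) : ‖fderiv ℝ f x (e j)‖ ≤ ‖fderiv ℝ f x‖ :=
    (fderiv ℝ f x).unit_le_opNorm _ (by simp)
  calc ‖dbar σ f x‖ ≤ ‖fderiv ℝ f x (e 0)‖ + ‖σ‖ * ‖fderiv ℝ f x (e 1)‖ := by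
        rw [dbar, norm_mul, norm_neg, Complex.norm_I, one_mul, ← norm_mul]
        exact norm_add_le _ _
    _ ≤ (1 + ‖σ‖) * ‖fderiv ℝ f x‖ := by
        rw [add_mul, one_mul]
        gcongr <;> exact he _

theorem measurable_dbar (σ : ℂ) (f : Plane → ℂ) : Measurable (dbar σ f) :=
  measurable_const.mul ((measurable_fderiv_apply_const ℝ f (e 0)).add
    (measurable_const.mul (measurable_fderiv_apply_const ℝ f (e 1))))

theorem continuous_dbar (hf : ContDiff ℝ 1 f) : Continuous (dbar σ f) := by
  have := hf.continuous_fderiv one_ne_zero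
  exact continuous_const.mul ((this.clm_apply continuous_const).add
    (continuous_const.mul (this.clm_apply continuous_const)))

theorem continuous_component (A : C(Plane, Plane)) (j : Fin 2) : Continuous fun x => A x j :=
  (EuclideanSpace.proj (𝕜 := ℝ) j).continuous.comp A.continuous

theorem continuous_ladderPotential (A : C(Plane, Plane)) (σ : ℂ) :
    Continuous (ladderPotential A σ) :=
  (Complex.continuous_ofReal.comp (continuous_component A 0)).add
    (continuous_const.mul (Complex.continuous_ofReal.comp (continuous_component A 1)))

theorem continuous_ladderFun (hf : ContDiff ℝ 1 f) : Continuous (ladderFun A σ f) :=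
  (continuous_dbar hf).sub ((continuous_ladderPotential A σ).mul hf.continuous)

theorem hasCompactSupport_dbar (hf : HasCompactSupport f) : HasCompactSupport (dbar σ f) :=
  HasCompactSupport.intro hf fun x hx => by
    simp [dbar, fderiv_of_notMem_tsupport ℝ hx]

theorem hasCompactSupport_ladderFun (hf : HasCompactSupport f) :
    HasCompactSupport (ladderFun A σ f) :=
  (hasCompactSupport_dbar hf).sub hf.mul_left

theorem integral_dbar_eq_zero (hf : Differentiable ℝ f) (hc : HasCompactSupport f)
    (hi : Integrable (dbar σ f)) : ∫ x, dbar σ f x = 0 := by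
  have key (x : Plane) : ∑ i, fderiv ℝ (![f, σ • f] i) x (e i) = Complex.I * dbar σ f x := by
    rw [Fin.sum_univ_two, Matrix.cons_val_zero, Matrix.cons_val_one, Matrix.cons_val_fin_one,
      fderiv_const_smul (hf x), smul_apply, smul_eq_mul, dbar, neg_mul, mul_neg, ← mul_assoc,
      Complex.I_mul_I, neg_one_mul, neg_neg]
  have h := integral_divergence_eq_zero (f := ![f, σ • f])
    (Fin.forall_fin_two.2 ⟨hf, hf.const_smul σ⟩)
    (Fin.forall_fin_two.2 ⟨hc, hc.smul_left (f := fun _ => σ)⟩)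
    (by simpa only [key] using hi.const_mul _)
  simp only [key, integral_const_mul] at h
  exact (mul_eq_zero.1 h).resolve_left Complex.I_ne_zero

theorem integral_mul_conj_ladderFun (hf : Differentiable ℝ f)
    (hf' : LocallyIntegrable (dbar σ f)) (hg : ContDiff ℝ 1 g) (hgc : HasCompactSupport g) :
    ∫ x, f x * conj (ladderFun A (conj σ) g x) = ∫ x, ladderFun A σ f x * conj (g x) := by
  have hgd : Differentiable ℝ g := hg.differentiable one_ne_zero
  have hcg : Continuous fun x => conj (g x) := Complex.continuous_conj.comp hg.continuous
  have hcgc : HasCompactSupport fun x => conj (g x) :=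
    hgc.comp_left (g := fun z : ℂ => conj z) (map_zero _)
  have hcgd : Differentiable ℝ fun x => conj (g x) := fun x =>
    (Complex.conjCLE : ℂ →L[ℝ] ℂ).differentiableAt.comp x (hgd x)
  have hleft : Integrable fun x => f x * conj (ladderFun A (conj σ) g x) :=
    (hf.continuous.mul (Complex.continuous_conj.comp
      (continuous_ladderFun hg))).integrable_of_hasCompactSupport
      ((hasCompactSupport_ladderFun hgc).comp_left (g := fun z : ℂ => conj z)
        (map_zero _)).mul_left
  have hright : Integrable fun x => ladderFun A σ f x * conj (g x) :=
    (hf'.sub ((continuous_ladderPotential A σ).mul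
      hf.continuous).locallyIntegrable).integrable_smul_right_of_hasCompactSupport hcg hcgc
  have key (x : Plane) : f x * conj (ladderFun A (conj σ) g x) - ladderFun A σ f x * conj (g x) =
      -dbar σ (f * fun y => conj (g y)) x := by
    rw [dbar_mul (hf x) (hcgd x), dbar_conj (hgd x), ladderFun, ladderFun, map_sub, map_mul,
      conj_ladderPotential]
    ring
  rw [← sub_eq_zero, ← integral_sub hleft hright]
  simp only [key]
  rw [integral_neg, integral_dbar_eq_zero (hf.mul hcgd) hcgc.mul_left, neg_zero]
  simpa only [key, Pi.neg_apply, neg_neg] using (hleft.sub hright).neg.congr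
    (Eventually.of_forall fun x => by rw [Pi.neg_apply, Pi.sub_apply, key, neg_neg])

end FirstOrder

section TestFunctions

variable {A : C(Plane, Plane)}

theorem contDiff_test (φ : Test) {n : ℕ∞} : ContDiff ℝ n φ := φ.contDiff.of_le (mod_cast le_top)

theorem differentiable_test (φ : Test) : Differentiable ℝ φ := φ.contDiff.differentiable (by simp)

theorem dense_range_testToL2 : Dense (LinearMap.range testToL2 : Set L2) := by
  refine (Lp.dense_hasCompactSupport_contDiff (E := Plane) (F := ℂ) (μ := volume)
    (p := 2) (by norm_num)).mono ?_
  rintro f ⟨g, hfg, hgc, hgs⟩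
  let φ : Test := ⟨g, hgs, hgc, fun x _ => mem_univ x⟩
  exact ⟨φ, Lp.ext (((memLp_test φ).coeFn_toLp).trans hfg.symm)⟩

theorem coeFn_testToL2 (φ : Test) : testToL2 φ =ᵐ[volume] φ := (memLp_test φ).coeFn_toLp

theorem coeFn_momentumTest (φ : Test) : momentumTest A φ =ᵐ[volume] momentumFun A φ :=
  (memLp_momentumFun A φ).coeFn_toLp

theorem inner_testToL2 (φ : Test) (g : L2) : ⟪testToL2 φ, g⟫_ℂ = ∫ x, g x * conj (φ x) := by
  rw [L2.inner_def]
  refine integral_congr_ae ?_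
  filter_upwards [coeFn_testToL2 φ] with x hx
  rw [RCLike.inner_apply, hx]

/-- The map `(u₁, u₂) ↦ u₁ + σ u₂` from `L²(ℝ²; ℂ²)` to `L²(ℝ²)`. -/
def ladderL2 (σ : ℂ) : L2Vec →L[ℂ] L2 :=
  (EuclideanSpace.proj 0 + σ • EuclideanSpace.proj 1 :
    EuclideanSpace ℂ (Fin 2) →L[ℂ] ℂ).compLpL 2 volume

theorem coeFn_ladderL2 (σ : ℂ) (w : L2Vec) :
    ladderL2 σ w =ᵐ[volume] fun x => w x 0 + σ * w x 1 :=
  (EuclideanSpace.proj 0 + σ • EuclideanSpace.proj 1 :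
    EuclideanSpace ℂ (Fin 2) →L[ℂ] ℂ).coeFn_compLpL w

/-- The operator `π₁ + σ π₂`, where `π = p - A`, on test functions. -/
def ladderTest (A : C(Plane, Plane)) (σ : ℂ) : Test →ₗ[ℂ] L2 :=
  (ladderL2 σ : L2Vec →ₗ[ℂ] L2) ∘ₗ momentumTest A

theorem momentumFun_add_smul (σ : ℂ) (φ : Test) (x : Plane) :
    momentumFun A φ x 0 + σ * momentumFun A φ x 1 = ladderFun A σ φ x := by
  simp only [momentumFun, ladderFun, dbar, ladderPotential]
  ring

theorem coeFn_ladderTest (σ : ℂ) (φ : Test) :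
    ladderTest A σ φ =ᵐ[volume] ladderFun A σ φ := by
  filter_upwards [coeFn_ladderL2 σ (momentumTest A φ), coeFn_momentumTest φ] with x h hφ
  change ladderL2 σ (momentumTest A φ) x = _
  rw [h, hφ, momentumFun_add_smul]

theorem inner_ladderTest (σ : ℂ) (φ : Test) (g : L2) :
    ⟪ladderTest A σ φ, g⟫_ℂ = ∫ x, g x * conj (ladderFun A σ φ x) := by
  rw [L2.inner_def]
  refine integral_congr_ae ?_
  filter_upwards [coeFn_ladderTest σ φ] with x hx
  rw [RCLike.inner_apply, hx]

end TestFunctions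

section Commutator

variable {A : C(Plane, Plane)} {B : Plane → ℝ}

theorem continuous_momentumFun (φ : Test) (j : Fin 2) :
    Continuous fun x => momentumFun A φ x j :=
  (continuous_const.mul (((contDiff_test φ (n := 1)).continuous_fderiv (by simp)).clm_apply
    continuous_const)).sub
    ((Complex.continuous_ofReal.comp (continuous_component A j)).mul φ.continuous)

theorem hasCompactSupport_momentumFun (φ : Test) (j : Fin 2) :
    HasCompactSupport fun x => momentumFun A φ x j :=
  HasCompactSupport.intro φ.hasCompactSupport fun x hx => by
    simp [momentumFun, image_eq_zero_of_notMem_tsupport hx, fderiv_of_notMem_tsupport ℝ hx]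

theorem integrable_momentumFun_mul_conj (φ ψ : Test) (j k : Fin 2) :
    Integrable fun x => momentumFun A ψ x j * conj (momentumFun A φ x k) :=
  ((continuous_momentumFun ψ j).mul (Complex.continuous_conj.comp
    (continuous_momentumFun φ k))).integrable_of_hasCompactSupport
    (hasCompactSupport_momentumFun ψ j).mul_right

theorem hasFDerivAt_momentumFun (hA : Differentiable ℝ A) (ψ : Test) (j : Fin 2) (x : Plane) :
    HasFDerivAt (fun x => momentumFun A ψ x j)
      (-Complex.I • (ContinuousLinearMap.apply ℝ ℂ (e j)).comp (fderiv ℝ (fderiv ℝ ψ) x) -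
        ((A x j : ℂ) • fderiv ℝ ψ x + ψ x • Complex.ofRealCLM.comp
          ((EuclideanSpace.proj (𝕜 := ℝ) j).comp (fderiv ℝ A x)))) x := by
  have hAj : HasFDerivAt (fun x => (A x j : ℂ)) _ x :=
    Complex.ofRealCLM.hasFDerivAt.comp x
      ((EuclideanSpace.proj (𝕜 := ℝ) j).hasFDerivAt.comp x (hA x).hasFDerivAt)
  have hψ' : HasFDerivAt (fun x => fderiv ℝ ψ x (e j)) _ x :=
    (ContinuousLinearMap.apply ℝ ℂ (e j)).hasFDerivAt.comp x
      (((contDiff_test ψ (n := 2)).fderiv_right (m := 1) (by norm_num)).differentiable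
        one_ne_zero x).hasFDerivAt
  exact (hψ'.const_mul (-Complex.I)).sub (hAj.mul (differentiable_test ψ x).hasFDerivAt)

theorem curl_momentumFun (hA : IsVectorPotential A B) (ψ : Test) (x : Plane) :
    fderiv ℝ (fun x => momentumFun A ψ x 1) x (e 0) -
      fderiv ℝ (fun x => momentumFun A ψ x 0) x (e 1) =
      Complex.I * (A x 0 * momentumFun A ψ x 1 - A x 1 * momentumFun A ψ x 0) - B x * ψ x := by
  have hsymm : fderiv ℝ (fderiv ℝ ψ) x (e 0) (e 1) = fderiv ℝ (fderiv ℝ ψ) x (e 1) (e 0) :=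
    (contDiff_test ψ (n := 2)).contDiffAt.isSymmSndFDerivAt
      (by rw [minSmoothness_of_isRCLikeNormedField]; rfl) (e 0) (e 1)
  rw [(hasFDerivAt_momentumFun hA.1 ψ 1 x).fderiv, (hasFDerivAt_momentumFun hA.1 ψ 0 x).fderiv,
    ← hA.2 x]
  simp only [neg_smul, sub_apply, neg_apply, smul_apply, ContinuousLinearMap.comp_apply,
    ContinuousLinearMap.apply_apply, hsymm, smul_eq_mul, add_apply, PiLp.proj_apply,
    Complex.ofRealCLM_apply, sub_sub_sub_cancel_left, momentumFun, neg_mul, Complex.ofReal_sub]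
  ring_nf
  simp only [Complex.I_sq]
  ring

theorem fderiv_conj_test (φ : Test) (j : Fin 2) (x : Plane) :
    fderiv ℝ (fun x => conj (φ x)) x (e j) =
      -Complex.I * (conj (momentumFun A φ x j) + A x j * conj (φ x)) := by
  have h : fderiv ℝ (fun y => conj (φ y)) x = (Complex.conjCLE : ℂ →L[ℝ] ℂ).comp (fderiv ℝ φ x) :=
    ((Complex.conjCLE : ℂ →L[ℝ] ℂ).hasFDerivAt.comp x (differentiable_test φ x).hasFDerivAt).fderiv
  rw [h]
  simp [momentumFun, ← mul_assoc]

/-- The canonical commutation relation `[π₁, π₂] = i B` in the sense of quadratic forms. -/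
theorem integral_commutator (hA : IsVectorPotential A B) (hB : Continuous B) (φ ψ : Test) :
    ∫ x, (momentumFun A ψ x 1 * conj (momentumFun A φ x 0) -
        momentumFun A ψ x 0 * conj (momentumFun A φ x 1)) =
      Complex.I * ∫ x, B x * ψ x * conj (φ x) := by
  set X : Fin 2 → Plane → ℂ := ![fun x => momentumFun A ψ x 1 * conj (φ x),
    fun x => -(momentumFun A ψ x 0 * conj (φ x))]
  have hφc : HasCompactSupport fun x => conj (φ x) :=
    φ.hasCompactSupport.comp_left (g := fun z : ℂ => conj z) (map_zero _)
  have hφd : Differentiable ℝ fun x => conj (φ x) := fun x =>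
    (Complex.conjCLE : ℂ →L[ℝ] ℂ).differentiableAt.comp x (differentiable_test φ x)
  have hψd (j : Fin 2) : Differentiable ℝ fun x => momentumFun A ψ x j := fun x =>
    (hasFDerivAt_momentumFun hA.1 ψ j x).differentiableAt
  have hBint : Integrable fun x => B x * ψ x * conj (φ x) :=
    (((Complex.continuous_ofReal.comp hB).mul ψ.continuous).mul
      (Complex.continuous_conj.comp φ.continuous)).integrable_of_hasCompactSupport hφc.mul_left
  have hcomm : Integrable fun x => momentumFun A ψ x 1 * conj (momentumFun A φ x 0) -
      momentumFun A ψ x 0 * conj (momentumFun A φ x 1) :=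
    (integrable_momentumFun_mul_conj φ ψ 1 0).sub (integrable_momentumFun_mul_conj φ ψ 0 1)
  have hdiv (x : Plane) : ∑ i, fderiv ℝ (X i) x (e i) =
      -Complex.I * (momentumFun A ψ x 1 * conj (momentumFun A φ x 0) -
        momentumFun A ψ x 0 * conj (momentumFun A φ x 1)) - B x * ψ x * conj (φ x) := by
    simp only [X, Fin.sum_univ_two, Matrix.cons_val_zero, Matrix.cons_val_one,
      Matrix.cons_val_fin_one, fderiv_fun_neg, fderiv_fun_mul (hψd _ x) (hφd x), neg_apply,
      add_apply, smul_apply, smul_eq_mul, fderiv_conj_test (A := A)]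
    linear_combination conj (φ x) * curl_momentumFun hA ψ x
  have h := integral_divergence_eq_zero (f := X)
    (Fin.forall_fin_two.2 ⟨(hψd 1).mul hφd, ((hψd 0).mul hφd).neg⟩)
    (Fin.forall_fin_two.2 ⟨hφc.mul_left, hφc.mul_left.neg⟩)
    (by simp only [hdiv]; exact (hcomm.const_mul _).sub hBint)
  simp only [hdiv] at h
  rw [integral_sub (hcomm.const_mul _) hBint, integral_const_mul] at h
  linear_combination Complex.I * h + (∫ x, (momentumFun A ψ x 1 * conj (momentumFun A φ x 0) -
    momentumFun A ψ x 0 * conj (momentumFun A φ x 1))) * Complex.I_sq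

end Commutator

section LpConvergence

theorem tendsto_eLpNorm_zero_of_dominated {α F : Type*} [MeasurableSpace α] {μ : Measure α}
    [NormedAddCommGroup F] {p : NNReal} {f : ℕ → α → F} {b : α → ℝ}
    (hf : ∀ n, AEStronglyMeasurable (f n) μ) (hb : MemLp b p μ)
    (hfb : ∀ n, ∀ᵐ x ∂μ, ‖f n x‖ ≤ b x) (hlim : ∀ᵐ x ∂μ, Tendsto (f · x) atTop (𝓝 0)) :
    Tendsto (fun n => eLpNorm (f n) p μ) atTop (𝓝 0) := by
  rcases eq_or_ne p 0 with rfl | hp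
  · simp
  have hp' : (0 : ℝ) < p := NNReal.coe_pos.2 hp.bot_lt
  suffices Tendsto (fun n => ∫⁻ x, ‖f n x‖ₑ ^ (p : ℝ) ∂μ) atTop (𝓝 0) by
    have h := this.ennrpow_const (1 / (p : ℝ))
    rw [ENNReal.zero_rpow_of_pos (by positivity)] at h
    exact h.congr fun n => (eLpNorm_nnreal_eq_lintegral hp).symm
  have hzero : ∫⁻ _, (0 : ENNReal) ∂μ = 0 := lintegral_zero
  rw [← hzero]
  refine tendsto_lintegral_of_dominated_convergence' (fun x => ‖b x‖ₑ ^ (p : ℝ))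
    (fun n => (hf n).enorm.pow_const _) (fun n => ?_)
    (lintegral_rpow_enorm_lt_top_of_eLpNorm_lt_top (by simpa using hp) ENNReal.coe_ne_top
      hb.2).ne ?_
  · filter_upwards [hfb n] with x hx
    exact ENNReal.rpow_le_rpow (enorm_le_iff_norm_le.2 (hx.trans (le_abs_self _))) hp'.le
  · filter_upwards [hlim] with x hx
    have h := hx.enorm.ennrpow_const (p : ℝ)
    rwa [enorm_zero, ENNReal.zero_rpow_of_pos hp'] at h

variable {G : Type*} [NormedAddCommGroup G] [NormedSpace ℝ G] [FiniteDimensional ℝ G]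
  [HasContDiffBump G] [MeasurableSpace G] [BorelSpace G] {μ : Measure G} [μ.IsAddHaarMeasure]
  {p : NNReal}

theorem tendsto_eLpNorm_mul_convolution_normed_sub (hp : 1 ≤ p) {a f : G → ℂ} (ha : Continuous a)
    (hf : MemLp f p μ) (hc : HasCompactSupport f) {ι : Type*} {l : Filter ι}
    {ρ : ι → ContDiffBump (0 : G)} (hρ : Tendsto (fun i => (ρ i).rOut) l (𝓝 0)) :
    Tendsto (fun i => eLpNorm
      (a * ((ρ i).normed μ ⋆[ContinuousLinearMap.lsmul ℝ ℝ, μ] f - f)) p μ) l (𝓝 0) := by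
  have := FiniteDimensional.proper_real G
  obtain ⟨C, hC⟩ := (hc.isCompact.cthickening (r := 1)).exists_bound_of_continuousOn ha.continuousOn
  have hlim := ENNReal.Tendsto.const_mul (a := ENNReal.ofReal C)
    (tendsto_eLpNorm_convolution_normed_sub hp hf hρ) (Or.inr ENNReal.ofReal_ne_top)
  rw [mul_zero] at hlim
  refine tendsto_of_tendsto_of_tendsto_of_le_of_le' tendsto_const_nhds hlim
    (Eventually.of_forall fun _ => zero_le) ?_
  filter_upwards [hρ.eventually_le_const one_pos] with i hi
  refine eLpNorm_le_mul_eLpNorm_of_ae_le_mul (Eventually.of_forall fun x => ?_) p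
  rw [Pi.mul_apply, norm_mul]
  by_cases hx : x ∈ Metric.cthickening 1 (tsupport f)
  · exact mul_le_mul_of_nonneg_right (hC x hx) (norm_nonneg _)
  have hfx : f x = 0 := image_eq_zero_of_notMem_tsupport fun h =>
    hx (Metric.self_subset_cthickening _ h)
  have hρx : ((ρ i).normed μ ⋆[ContinuousLinearMap.lsmul ℝ ℝ, μ] f) x = 0 := by
    by_contra hne
    have hmem := support_convolution_subset _ (Function.mem_support.2 hne)
    rw [(ρ i).support_normed_eq, ball_add_zero] at hmem
    exact hx (Metric.thickening_subset_cthickening_of_le hi _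
      (Metric.thickening_subset_of_subset _ (subset_tsupport f) hmem))
  rw [Pi.sub_apply, hfx, hρx, sub_zero, norm_zero, mul_zero, mul_zero]

end LpConvergence

section WeakLadder

/-- `g` is the weak `π₁ + σ π₂`-derivative of `f`. -/
def IsWeakLadder (A : C(Plane, Plane)) (σ : ℂ) (f g : Plane → ℂ) : Prop :=
  ∀ φ : Test, ∫ x, f x * conj (ladderFun A (conj σ) φ x) = ∫ x, g x * conj (φ x)

/-- The graph of the operator `π₁ + σ π₂` on test functions. -/
def minLadder (A : C(Plane, Plane)) (σ : ℂ) : Submodule ℂ (L2 × L2) :=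
  LinearMap.range (testToL2.prod (ladderTest A σ))

variable {A : C(Plane, Plane)} {σ : ℂ} {f g : Plane → ℂ}

theorem mem_adjoint_minLadder_iff {p : L2 × L2} :
    p ∈ (minLadder A (conj σ)).adjoint ↔ IsWeakLadder A σ p.1 p.2 := by
  have h : p ∈ (minLadder A (conj σ)).adjoint ↔
      ∀ φ : Test, ⟪ladderTest A (conj σ) φ, p.1⟫_ℂ - ⟪testToL2 φ, p.2⟫_ℂ = 0 := by
    rw [Submodule.mem_adjoint_iff]
    exact ⟨fun h φ => h _ _ ⟨φ, rfl⟩, by rintro h _ _ ⟨φ, hφ⟩; cases hφ; exact h φ⟩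
  simp only [h, IsWeakLadder, sub_eq_zero, inner_ladderTest, inner_testToL2]

theorem IsWeakLadder.congr {f' g' : Plane → ℂ} (h : IsWeakLadder A σ f g)
    (hf : f =ᵐ[volume] f') (hg : g =ᵐ[volume] g') : IsWeakLadder A σ f' g' := fun φ =>
  calc ∫ x, f' x * conj (ladderFun A (conj σ) φ x)
      = ∫ x, f x * conj (ladderFun A (conj σ) φ x) :=
        integral_congr_ae (hf.symm.mul EventuallyEq.rfl)
    _ = ∫ x, g x * conj (φ x) := h φ
    _ = ∫ x, g' x * conj (φ x) := integral_congr_ae (hg.mul EventuallyEq.rfl)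

theorem isWeakLadder_ladderFun (hf : Differentiable ℝ f) (hf' : LocallyIntegrable (dbar σ f)) :
    IsWeakLadder A σ f (ladderFun A σ f) := fun φ =>
  integral_mul_conj_ladderFun hf hf' (contDiff_test φ) φ.hasCompactSupport

theorem integrable_mul_conj_test (hf : LocallyIntegrable f) (φ : Test) :
    Integrable fun x => f x * conj (φ x) :=
  hf.integrable_smul_right_of_hasCompactSupport (Complex.continuous_conj.comp φ.continuous)
    (φ.hasCompactSupport.comp_left (g := fun z : ℂ => conj z) (map_zero _))

theorem integrable_mul_conj_ladderFun (hf : LocallyIntegrable f) (φ : Test) :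
    Integrable fun x => f x * conj (ladderFun A σ φ x) :=
  hf.integrable_smul_right_of_hasCompactSupport
    (Complex.continuous_conj.comp (continuous_ladderFun (contDiff_test φ)))
    ((hasCompactSupport_ladderFun φ.hasCompactSupport).comp_left (g := fun z : ℂ => conj z)
      (map_zero _))

/-- The test function `χ̄ φ`. -/
def conjMulTest (χ : Plane → ℂ) (hχ : ContDiff ℝ ∞ χ) (φ : Test) : Test where
  toFun x := conj (χ x) * φ x
  contDiff' := ((Complex.conjCLE : ℂ →L[ℝ] ℂ).contDiff.comp hχ).mul φ.contDiff
  hasCompactSupport' := φ.hasCompactSupport.mul_left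
  tsupport_subset' := fun x _ => mem_univ x

theorem conj_ladderFun_conjMulTest {χ : Plane → ℂ} (hχ : ContDiff ℝ ∞ χ) (φ : Test) (x : Plane) :
    conj (ladderFun A (conj σ) (conjMulTest χ hχ φ) x) =
      χ x * conj (ladderFun A (conj σ) φ x) - dbar σ χ x * conj (φ x) := by
  have hχd : DifferentiableAt ℝ χ x := hχ.differentiable (by simp) x
  have hχc : DifferentiableAt ℝ (fun y => conj (χ y)) x :=
    (Complex.conjCLE : ℂ →L[ℝ] ℂ).differentiableAt.comp x hχd
  have h := ladderFun_mul (A := A) (σ := conj σ) hχc (differentiable_test φ x)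
  change ladderFun A (conj σ) (conjMulTest χ hχ φ) x = _ at h
  rw [h, dbar_conj hχd, Complex.conj_conj, map_add, map_mul, map_mul, map_neg, Complex.conj_conj,
    Complex.conj_conj]
  ring

theorem IsWeakLadder.mul {χ : Plane → ℂ} (h : IsWeakLadder A σ f g) (hf : LocallyIntegrable f)
    (hg : LocallyIntegrable g) (hχ : ContDiff ℝ ∞ χ) :
    IsWeakLadder A σ (χ * f) (χ * g + dbar σ χ * f) := fun φ => by
  have hχf : LocallyIntegrable (dbar σ χ * f) :=
    hf.continuous_mul (continuous_dbar (hχ.of_le (mod_cast le_top)))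
  have hfφ (x : Plane) : (χ * f) x * conj (ladderFun A (conj σ) φ x) =
      f x * conj (ladderFun A (conj σ) (conjMulTest χ hχ φ) x) +
        (dbar σ χ * f) x * conj (φ x) := by
    rw [conj_ladderFun_conjMulTest, Pi.mul_apply, Pi.mul_apply]
    ring
  have hgφ (x : Plane) : (χ * g + dbar σ χ * f) x * conj (φ x) =
      g x * conj (conjMulTest χ hχ φ x) + (dbar σ χ * f) x * conj (φ x) := by
    change _ = g x * conj (conj (χ x) * φ x) + _
    rw [Pi.add_apply, Pi.mul_apply, map_mul, Complex.conj_conj]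
    ring
  simp only [hfφ, hgφ]
  rw [integral_add (integrable_mul_conj_ladderFun hf _) (integrable_mul_conj_test hχf φ), h,
    integral_add (integrable_mul_conj_test hg _) (integrable_mul_conj_test hχf φ)]

theorem IsWeakLadder.zero_potential (h : IsWeakLadder A σ f g) (hf : LocallyIntegrable f)
    (hg : LocallyIntegrable g) : IsWeakLadder 0 σ f (g + ladderPotential A σ * f) := fun φ => by
  have haf : LocallyIntegrable (ladderPotential A σ * f) :=
    hf.continuous_mul (continuous_ladderPotential A σ)
  have hfφ (x : Plane) : f x * conj (ladderFun 0 (conj σ) φ x) =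
      f x * conj (ladderFun A (conj σ) φ x) + (ladderPotential A σ * f) x * conj (φ x) := by
    have h0 : ladderPotential 0 (conj σ) x = 0 := by simp [ladderPotential]
    rw [ladderFun, ladderFun, h0, map_sub, map_sub, map_mul, map_mul, conj_ladderPotential,
      Pi.mul_apply, map_zero]
    ring
  simp only [hfφ, Pi.add_apply (g), add_mul]
  rw [integral_add (integrable_mul_conj_ladderFun hf φ) (integrable_mul_conj_test haf φ), h,
    integral_add (integrable_mul_conj_test hg φ) (integrable_mul_conj_test haf φ)]

end WeakLadder

section Friedrichs

variable {A : C(Plane, Plane)} {σ : ℂ} {f g : Plane → ℂ}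

theorem fderiv_convolution_normed (ρ : ContDiffBump (0 : Plane)) (hf : LocallyIntegrable f)
    (x v : Plane) : fderiv ℝ (ρ.normed volume ⋆[ContinuousLinearMap.lsmul ℝ ℝ] f) x v =
      ∫ t, fderiv ℝ (ρ.normed volume) (x - t) v * f t := by
  have hex : ConvolutionExistsAt (fderiv ℝ (ρ.normed volume)) f x
      (ContinuousLinearMap.precompL Plane (ContinuousLinearMap.lsmul ℝ ℝ)) volume :=
    (ρ.hasCompactSupport_normed.fderiv ℝ).convolutionExists_left _
      (ρ.contDiff_normed.continuous_fderiv one_ne_zero) hf x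
  rw [(ρ.hasCompactSupport_normed.hasFDerivAt_convolution_left _ ρ.contDiff_normed hf x).fderiv,
    convolution_eq_swap, ContinuousLinearMap.integral_apply hex.integrable_swap]
  rfl

/-- The test function `t ↦ ρ (x - t)`. -/
def shiftedBump (ρ : ContDiffBump (0 : Plane)) (x : Plane) : Test where
  toFun t := (ρ.normed volume (x - t) : ℂ)
  contDiff' := Complex.ofRealCLM.contDiff.comp
    (ρ.contDiff_normed.comp (contDiff_const.sub contDiff_id))
  hasCompactSupport' := (ρ.hasCompactSupport_normed.comp_homeomorph
    (Homeomorph.subLeft x)).comp_left Complex.ofReal_zero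
  tsupport_subset' := fun x _ => mem_univ x

theorem shiftedBump_apply (ρ : ContDiffBump (0 : Plane)) (x t : Plane) :
    shiftedBump ρ x t = (ρ.normed volume (x - t) : ℂ) := rfl

theorem fderiv_shiftedBump (ρ : ContDiffBump (0 : Plane)) (x t v : Plane) :
    fderiv ℝ (shiftedBump ρ x) t v = -(fderiv ℝ (ρ.normed volume) (x - t) v : ℂ) := by
  have hρ : HasFDerivAt (ρ.normed volume) (fderiv ℝ (ρ.normed volume) (x - t)) (x - t) :=
    (ρ.contDiff_normed.differentiable one_ne_zero _).hasFDerivAt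
  have h : HasFDerivAt (shiftedBump ρ x) _ t :=
    Complex.ofRealCLM.hasFDerivAt.comp t (hρ.comp t ((hasFDerivAt_id t).const_sub x))
  rw [h.fderiv]
  simp

/-- The mollification of a compactly supported function, as a test function. -/
def mollify (ρ : ContDiffBump (0 : Plane)) (f : Plane → ℂ) (hf : LocallyIntegrable f)
    (hc : HasCompactSupport f) : Test where
  toFun := ρ.normed volume ⋆[ContinuousLinearMap.lsmul ℝ ℝ] f
  contDiff' := ρ.hasCompactSupport_normed.contDiff_convolution_left _ ρ.contDiff_normed hf
  hasCompactSupport' := ρ.hasCompactSupport_normed.convolution _ hc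
  tsupport_subset' := fun x _ => mem_univ x

theorem IsWeakLadder.dbar_convolution_normed (h : IsWeakLadder 0 σ f g)
    (hf : LocallyIntegrable f) (ρ : ContDiffBump (0 : Plane)) (x : Plane) :
    dbar σ (ρ.normed volume ⋆[ContinuousLinearMap.lsmul ℝ ℝ] f) x =
      (ρ.normed volume ⋆[ContinuousLinearMap.lsmul ℝ ℝ] g) x := by
  have hint (j : Fin 2) :
      Integrable fun t => (fderiv ℝ (ρ.normed volume) (x - t) (e j) : ℂ) * f t := by
    have hc := contDiff_test (shiftedBump ρ x) (n := 1)
    have := hf.integrable_smul_left_of_hasCompactSupport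
      ((hc.continuous_fderiv one_ne_zero).clm_apply (continuous_const (y := e j)))
      ((shiftedBump ρ x).hasCompactSupport.fderiv_apply ℝ (e j))
    simpa only [fderiv_shiftedBump, smul_eq_mul, neg_mul, Pi.neg_def, neg_neg] using this.neg
  have hf_test (t : Plane) : f t * conj (ladderFun 0 (conj σ) (shiftedBump ρ x) t) =
      -Complex.I * (fderiv ℝ (ρ.normed volume) (x - t) (e 0) * f t +
        σ * (fderiv ℝ (ρ.normed volume) (x - t) (e 1) * f t)) := by
    have h0 : ladderPotential 0 (conj σ) t = 0 := by simp [ladderPotential]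
    simp only [ladderFun, h0, dbar, fderiv_shiftedBump, zero_mul, sub_zero, map_mul, map_neg,
      map_add, Complex.conj_I, Complex.conj_conj, Complex.conj_ofReal]
    ring
  have hg_test (t : Plane) : g t * conj (shiftedBump ρ x t) = ρ.normed volume (x - t) • g t := by
    rw [shiftedBump_apply, Complex.conj_ofReal, mul_comm, Complex.real_smul]
  have := h (shiftedBump ρ x)
  simp only [hf_test, hg_test] at this
  rw [integral_const_mul, integral_add (hint 0) ((hint 1).const_mul σ), integral_const_mul] at this
  rw [dbar, fderiv_convolution_normed ρ hf, fderiv_convolution_normed ρ hf, this,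
    convolution_eq_swap]
  rfl

theorem exists_tendsto_rOut :
    ∃ ρ : ℕ → ContDiffBump (0 : Plane), Tendsto (fun n => (ρ n).rOut) atTop (𝓝 0) := by
  refine ⟨fun n => ⟨1 / (n + 1) / 2, 1 / (n + 1), by positivity, half_lt_self (by positivity)⟩, ?_⟩
  exact tendsto_one_div_add_atTop_nhds_zero_nat

theorem memLp_continuous_mul {a : Plane → ℂ} (ha : Continuous a) (hf : MemLp f 2 volume)
    (hc : HasCompactSupport f) : MemLp (a * f) 2 volume := by
  obtain ⟨C, hC⟩ := hc.isCompact.exists_bound_of_continuousOn ha.continuousOn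
  refine hf.of_le_mul (c := C) (ha.aestronglyMeasurable.mul hf.1) (Eventually.of_forall fun x => ?_)
  rw [Pi.mul_apply, norm_mul]
  by_cases hx : x ∈ tsupport f
  · exact mul_le_mul_of_nonneg_right (hC x hx) (norm_nonneg _)
  · simp only [image_eq_zero_of_notMem_tsupport hx, norm_zero, mul_zero, le_refl]

theorem IsWeakLadder.tendsto_ladderFun_mollify (h : IsWeakLadder A σ f g) (hf : MemLp f 2 volume)
    (hg : MemLp g 2 volume) (hc : HasCompactSupport f) {ρ : ℕ → ContDiffBump (0 : Plane)}
    (hρ : Tendsto (fun n => (ρ n).rOut) atTop (𝓝 0)) (hloc : LocallyIntegrable f) :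
    Tendsto (fun n => eLpNorm (ladderFun A σ (mollify (ρ n) f hloc hc) - g) 2 volume)
      atTop (𝓝 0) := by
  set a := ladderPotential A σ
  have ha : Continuous a := continuous_ladderPotential A σ
  have haf : MemLp (a * f) 2 volume := memLp_continuous_mul ha hf hc
  have hgaf : MemLp (g + a * f) 2 volume := hg.add haf
  have hlocg : LocallyIntegrable (g + a * f) := hgaf.locallyIntegrable one_le_two
  let J (n : ℕ) (u : Plane → ℂ) : Plane → ℂ :=
    (ρ n).normed volume ⋆[ContinuousLinearMap.lsmul ℝ ℝ] u
  have hJ (n : ℕ) {u : Plane → ℂ} (hu : LocallyIntegrable u) :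
      AEStronglyMeasurable (J n u) volume :=
    ((ρ n).hasCompactSupport_normed.continuous_convolution_left _ (ρ n).continuous_normed
      hu).aestronglyMeasurable
  have key (n : ℕ) : ladderFun A σ (mollify (ρ n) f hloc hc) - g =
      (J n (g + a * f) - (g + a * f)) - a * (J n f - f) := by
    funext x
    have hx := (h.zero_potential hloc (hg.locallyIntegrable one_le_two)).dbar_convolution_normed
      hloc (ρ n) x
    change (dbar σ (J n f) x - a x * J n f x) - g x =
      (J n (g + a * f) x - (g x + a x * f x)) - a x * (J n f x - f x)
    rw [hx]
    ring
  have hlim := (tendsto_eLpNorm_convolution_normed_sub (p := 2) one_le_two hgaf hρ).add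
    (tendsto_eLpNorm_mul_convolution_normed_sub (p := 2) one_le_two ha hf hc hρ)
  rw [add_zero] at hlim
  refine tendsto_of_tendsto_of_tendsto_of_le_of_le tendsto_const_nhds hlim
    (fun _ => zero_le) fun n => ?_
  dsimp only
  rw [key]
  exact eLpNorm_sub_le ((hJ n hlocg).sub hgaf.1)
    (ha.aestronglyMeasurable.mul ((hJ n hloc).sub hf.1)) one_le_two

theorem IsWeakLadder.mem_closure_of_hasCompactSupport (h : IsWeakLadder A σ f g)
    (hf : MemLp f 2 volume) (hg : MemLp g 2 volume) (hc : HasCompactSupport f) :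
    (hf.toLp f, hg.toLp g) ∈ (minLadder A σ).topologicalClosure := by
  have hloc : LocallyIntegrable f := hf.locallyIntegrable one_le_two
  obtain ⟨ρ, hρ⟩ := exists_tendsto_rOut
  have hφ : Tendsto (fun n => testToL2 (mollify (ρ n) f hloc hc)) atTop (𝓝 (hf.toLp f)) :=
    (Lp.tendsto_Lp_iff_tendsto_eLpNorm'' _ (fun n => memLp_test _) _ hf).2
      (tendsto_eLpNorm_convolution_normed_sub (p := 2) one_le_two hf hρ)
  have hDφ : Tendsto (fun n => ladderTest A σ (mollify (ρ n) f hloc hc)) atTop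
      (𝓝 (hg.toLp g)) :=
    (Lp.tendsto_Lp_iff_tendsto_eLpNorm _ _ hg).2
      ((h.tendsto_ladderFun_mollify hf hg hc hρ hloc).congr fun n =>
        eLpNorm_congr_ae ((coeFn_ladderTest σ _).symm.sub EventuallyEq.rfl))
  exact mem_closure_of_tendsto (hφ.prodMk_nhds hDφ) (Eventually.of_forall fun n => ⟨_, rfl⟩)

end Friedrichs

section Cutoff

variable {A : C(Plane, Plane)} {σ : ℂ} {f g : Plane → ℂ}

/-- A smooth bump function on the plane that is `1` on the unit ball and `0` outside the ball of
radius `2`. -/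
def unitBump : ContDiffBump (0 : Plane) := ⟨1, 2, one_pos, one_lt_two⟩

/-- Smooth cutoffs, `1` on the ball of radius `n + 1` and `0` outside the ball of radius
`2 (n + 1)`. -/
def cutoff (n : ℕ) (x : Plane) : ℂ := (unitBump ((n + 1 : ℝ)⁻¹ • x) : ℝ)

theorem contDiff_cutoff (n : ℕ) : ContDiff ℝ ∞ (cutoff n) :=
  Complex.ofRealCLM.contDiff.comp (unitBump.contDiff.comp (contDiff_id.const_smul _))

theorem hasCompactSupport_cutoff (n : ℕ) : HasCompactSupport (cutoff n) :=
  (unitBump.hasCompactSupport.comp_smul (inv_ne_zero (Nat.cast_add_one_ne_zero n))).comp_left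
    Complex.ofReal_zero

theorem cutoff_eventually_eq_one (x : Plane) : ∀ᶠ n in atTop, cutoff n x = 1 := by
  filter_upwards [eventually_ge_atTop ⌈‖x‖⌉₊] with n hn
  have hx : ‖x‖ ≤ n + 1 := (Nat.ceil_le.1 hn).trans (by linarith)
  have hmem : (n + 1 : ℝ)⁻¹ • x ∈ Metric.closedBall 0 unitBump.rIn := by
    rw [mem_closedBall_zero_iff, norm_smul, norm_inv, Real.norm_of_nonneg (by positivity)]
    exact inv_mul_le_one_of_le₀ hx (by positivity)
  rw [cutoff, unitBump.one_of_mem_closedBall hmem, Complex.ofReal_one]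

theorem norm_cutoff_sub_one_le (n : ℕ) (x : Plane) : ‖cutoff n x - 1‖ ≤ 1 := by
  rw [cutoff, ← Complex.ofReal_one, ← Complex.ofReal_sub, Complex.norm_real, Real.norm_eq_abs,
    abs_le]
  exact ⟨by linarith [unitBump.nonneg (x := (n + 1 : ℝ)⁻¹ • x)],
    by linarith [unitBump.le_one (x := (n + 1 : ℝ)⁻¹ • x)]⟩

theorem tendsto_eLpNorm_cutoff_mul_sub (hf : MemLp f 2 volume) :
    Tendsto (fun n => eLpNorm (cutoff n * f - f) 2 volume) atTop (𝓝 0) := by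
  refine tendsto_eLpNorm_zero_of_dominated (p := 2) (b := fun x => ‖f x‖)
    (fun n => ((contDiff_cutoff n).continuous.aestronglyMeasurable.mul hf.1).sub hf.1)
    hf.norm (fun n => Eventually.of_forall fun x => ?_) (Eventually.of_forall fun x => ?_)
  · have hx : (cutoff n * f - f) x = (cutoff n x - 1) * f x := by
      rw [Pi.sub_apply, Pi.mul_apply]
      ring
    rw [hx, norm_mul]
    exact mul_le_of_le_one_left (norm_nonneg _) (norm_cutoff_sub_one_le n x)
  · refine tendsto_const_nhds.congr' ?_
    filter_upwards [cutoff_eventually_eq_one x] with n hn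
    rw [Pi.sub_apply, Pi.mul_apply, hn, one_mul, sub_self]

theorem exists_norm_dbar_cutoff_le (σ : ℂ) : ∃ C, ∀ n x, ‖dbar σ (cutoff n) x‖ ≤ C / (n + 1) := by
  let b (x : Plane) : ℂ := (unitBump x : ℝ)
  have hb : ContDiff ℝ 1 b := Complex.ofRealCLM.contDiff.comp unitBump.contDiff
  have hbc : HasCompactSupport b := unitBump.hasCompactSupport.comp_left Complex.ofReal_zero
  obtain ⟨C, hC⟩ := (hasCompactSupport_dbar (σ := σ) hbc).exists_bound_of_continuous
    (continuous_dbar hb)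
  refine ⟨C, fun n x => ?_⟩
  have hscale : dbar σ (cutoff n) x = (n + 1 : ℝ)⁻¹ • dbar σ b ((n + 1 : ℝ)⁻¹ • x) := by
    have h : fderiv ℝ (cutoff n) x = (n + 1 : ℝ)⁻¹ • fderiv ℝ b ((n + 1 : ℝ)⁻¹ • x) :=
      fderiv_comp_smul (f := b) (x := x) _
    simp only [dbar, h, smul_apply, Complex.real_smul]
    ring
  rw [hscale, norm_smul, norm_inv, Real.norm_of_nonneg (by positivity), div_eq_inv_mul]
  gcongr
  exact hC _

theorem tendsto_eLpNorm_dbar_cutoff_mul (σ : ℂ) (hf : MemLp f 2 volume) :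
    Tendsto (fun n => eLpNorm (dbar σ (cutoff n) * f) 2 volume) atTop (𝓝 0) := by
  obtain ⟨C, hC⟩ := exists_norm_dbar_cutoff_le σ
  have hC0 : 0 ≤ C := by simpa using (norm_nonneg _).trans (hC 0 0)
  have hle (n : ℕ) (x : Plane) : ‖(dbar σ (cutoff n) * f) x‖ ≤ C / (n + 1) * ‖f x‖ := by
    rw [Pi.mul_apply, norm_mul]
    exact mul_le_mul_of_nonneg_right (hC n x) (norm_nonneg _)
  refine tendsto_eLpNorm_zero_of_dominated (p := 2) (b := fun x => C * ‖f x‖)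
    (fun n => (measurable_dbar σ _).aestronglyMeasurable.mul hf.1) (hf.norm.const_mul C)
    (fun n => Eventually.of_forall fun x => ?_) (Eventually.of_forall fun x => ?_)
  · exact (hle n x).trans (mul_le_mul_of_nonneg_right
      (div_le_self hC0 (le_add_of_nonneg_left n.cast_nonneg)) (norm_nonneg _))
  · have h0 : Tendsto (fun n : ℕ => C / (n + 1) * ‖f x‖) atTop (𝓝 0) := by
      simpa [div_eq_mul_inv] using
        (tendsto_one_div_add_atTop_nhds_zero_nat (𝕜 := ℝ)).const_mul C |>.mul_const ‖f x‖
    exact squeeze_zero_norm (hle · x) h0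

theorem IsWeakLadder.mem_closure (h : IsWeakLadder A σ f g) (hf : MemLp f 2 volume)
    (hg : MemLp g 2 volume) : (hf.toLp f, hg.toLp g) ∈ (minLadder A σ).topologicalClosure := by
  have hmul {a u : Plane → ℂ} (ha : Continuous a) (hac : HasCompactSupport a)
      (hu : MemLp u 2 volume) : MemLp (a * u) 2 volume :=
    hu.mul (ha.memLp_top_of_hasCompactSupport hac volume)
  have hχf (n : ℕ) : MemLp (cutoff n * f) 2 volume :=
    hmul (contDiff_cutoff n).continuous (hasCompactSupport_cutoff n) hf
  have hχg (n : ℕ) : MemLp (cutoff n * g) 2 volume :=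
    hmul (contDiff_cutoff n).continuous (hasCompactSupport_cutoff n) hg
  have hχ'f (n : ℕ) : MemLp (dbar σ (cutoff n) * f) 2 volume :=
    hmul (continuous_dbar ((contDiff_cutoff n).of_le (mod_cast le_top)))
      (hasCompactSupport_dbar (hasCompactSupport_cutoff n)) hf
  have hlim := (tendsto_eLpNorm_cutoff_mul_sub hg).add (tendsto_eLpNorm_dbar_cutoff_mul σ hf)
  rw [add_zero] at hlim
  have hfst : Tendsto (fun n => (hχf n).toLp _) atTop (𝓝 (hf.toLp f)) :=
    (Lp.tendsto_Lp_iff_tendsto_eLpNorm'' _ hχf _ hf).2 (tendsto_eLpNorm_cutoff_mul_sub hf)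
  have hsnd : Tendsto (fun n => ((hχg n).add (hχ'f n)).toLp _) atTop (𝓝 (hg.toLp g)) := by
    refine (Lp.tendsto_Lp_iff_tendsto_eLpNorm'' _ (fun n => (hχg n).add (hχ'f n)) _ hg).2
      (tendsto_of_tendsto_of_tendsto_of_le_of_le tendsto_const_nhds hlim
        (fun _ => zero_le) fun n => ?_)
    dsimp only
    rw [add_sub_right_comm]
    exact eLpNorm_add_le ((hχg n).1.sub hg.1) (hχ'f n).1 one_le_two
  refine (minLadder A σ).isClosed_topologicalClosure.mem_of_tendsto (hfst.prodMk_nhds hsnd)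
    (Eventually.of_forall fun n => ?_)
  exact (h.mul (hf.locallyIntegrable one_le_two) (hg.locallyIntegrable one_le_two)
    (contDiff_cutoff n)).mem_closure_of_hasCompactSupport (hχf n) _
    (hasCompactSupport_cutoff n).mul_right

/-- Weak and strong extensions of `π₁ + σ π₂` agree. -/
theorem adjoint_minLadder (A : C(Plane, Plane)) (σ : ℂ) :
    (minLadder A (conj σ)).adjoint = (minLadder A σ).topologicalClosure := by
  refine le_antisymm (fun p hp => ?_) (Submodule.topologicalClosure_minimal _ ?_
    (isClosed_adjoint _))
  · have h := (mem_adjoint_minLadder_iff.1 hp).mem_closure (Lp.memLp p.1) (Lp.memLp p.2)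
    rwa [Lp.toLp_coeFn, Lp.toLp_coeFn] at h
  · rintro _ ⟨φ, rfl⟩
    refine mem_adjoint_minLadder_iff.2 (IsWeakLadder.congr (isWeakLadder_ladderFun
      (differentiable_test φ) ?_) (coeFn_testToL2 φ).symm (coeFn_ladderTest σ φ).symm)
    exact (continuous_dbar (contDiff_test φ)).locallyIntegrable

end Cutoff

section FormDomain

variable {A : C(Plane, Plane)} {σ : ℂ} {u f g : L2} {w : L2Vec}

theorem graph_momentum (A : C(Plane, Plane)) :
    (momentum A).graph = LinearMap.range (testToL2.prod (momentumTest A)) := by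
  ext p
  rw [LinearPMap.mem_graph_iff]
  constructor
  · rintro ⟨⟨_, φ, rfl⟩, hfst, hsnd⟩
    refine ⟨φ, Prod.ext hfst (Eq.trans ?_ hsnd)⟩
    exact congrArg (momentumTest A)
      ((LinearEquiv.ofInjective testToL2 testToL2_injective).symm_apply_apply φ).symm
  · rintro ⟨φ, rfl⟩
    refine ⟨⟨_, φ, rfl⟩, rfl, ?_⟩
    exact congrArg (momentumTest A)
      ((LinearEquiv.ofInjective testToL2 testToL2_injective).symm_apply_apply φ)

/-- The map `(u, w) ↦ (u, w₁ + σ w₂)`. -/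
def ladderProd (σ : ℂ) : L2 × L2Vec →L[ℂ] L2 × L2 :=
  (ContinuousLinearMap.id ℂ L2).prodMap (ladderL2 σ)

theorem map_ladderProd_graph_momentum (A : C(Plane, Plane)) (σ : ℂ) :
    (momentum A).graph.map (ladderProd σ : L2 × L2Vec →ₗ[ℂ] L2 × L2) = minLadder A σ := by
  rw [graph_momentum, ← LinearMap.range_comp]
  rfl

theorem ladderL2_mem_closure_minLadder (h : (u, w) ∈ (momentum A).graph.topologicalClosure) :
    (u, ladderL2 σ w) ∈ (minLadder A σ).topologicalClosure := by
  rw [← map_ladderProd_graph_momentum]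
  exact map_mem_closure (f := ladderProd σ) (ladderProd σ).continuous h fun p hp => ⟨p, hp, rfl⟩

theorem eq_zero_of_forall_ladderL2_eq_zero (h : ∀ σ, ladderL2 σ w = 0) : w = 0 := by
  refine Lp.ext ?_
  have h0 := coeFn_ladderL2 0 w
  have h1 := coeFn_ladderL2 1 w
  rw [h] at h0 h1
  filter_upwards [h0, h1, Lp.coeFn_zero ℂ 2 volume, Lp.coeFn_zero (EuclideanSpace ℂ (Fin 2)) 2
    volume] with x h0 h1 hz hz'
  rw [hz, Pi.zero_apply] at h0 h1
  rw [zero_mul, add_zero] at h0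
  rw [← h0, zero_add, one_mul] at h1
  rw [hz']
  ext j
  fin_cases j
  exacts [h0.symm, h1.symm]

theorem isClosable_momentum (A : C(Plane, Plane)) : (momentum A).IsClosable := by
  refine ⟨(momentum A).graph.topologicalClosure.toLinearPMap,
    (Submodule.toLinearPMap_graph_eq _ ?_).symm⟩
  rintro ⟨u, w⟩ h (rfl : u = 0)
  refine eq_zero_of_forall_ladderL2_eq_zero fun σ => ?_
  have hmem := ladderL2_mem_closure_minLadder (σ := σ) h
  rw [← adjoint_minLadder, Submodule.mem_adjoint_iff] at hmem
  refine dense_range_testToL2.eq_zero_of_inner_right ℂ ?_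
  rintro _ ⟨φ, rfl⟩
  simpa using hmem _ _ ⟨φ, rfl⟩

theorem mem_closure_graph_momentum_iff : (u, w) ∈ (momentum A).graph.topologicalClosure ↔
    ∃ h : u ∈ (momentum A).closure.domain, (momentum A).closure ⟨u, h⟩ = w := by
  rw [(isClosable_momentum A).graph_closure_eq_closure_graph, LinearPMap.mem_graph_iff]
  constructor
  · rintro ⟨v, rfl, h⟩
    exact ⟨v.2, h⟩
  · rintro ⟨h, hw⟩
    exact ⟨⟨u, h⟩, rfl, hw⟩

variable {B : Plane →ᵇ ℝ}

theorem inner_ladderL2_momentumTest (hA : IsVectorPotential A B) (hσ : conj σ = -σ)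
    (hσ' : σ * σ = -1) (φ ψ : Test) :
    ⟪ladderL2 σ (momentumTest A φ), ladderL2 σ (momentumTest A ψ)⟫_ℂ =
      ⟪momentumTest A φ, momentumTest A ψ⟫_ℂ +
        σ * Complex.I * ⟪testToL2 φ, potentialL B (testToL2 ψ)⟫_ℂ := by
  have hB : ⟪testToL2 φ, potentialL B (testToL2 ψ)⟫_ℂ = ∫ x, B x * ψ x * conj (φ x) := by
    rw [inner_testToL2]
    refine integral_congr_ae ?_
    filter_upwards [coeFn_potential B (testToL2 ψ), coeFn_testToL2 ψ] with x hx hψ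
    rw [potentialL_apply, hx, hψ]
  have hint : Integrable fun x => momentumFun A ψ x 1 * conj (momentumFun A φ x 0) -
      momentumFun A ψ x 0 * conj (momentumFun A φ x 1) :=
    (integrable_momentumFun_mul_conj φ ψ 1 0).sub (integrable_momentumFun_mul_conj φ ψ 0 1)
  rw [hB, mul_assoc, ← integral_commutator hA B.continuous, ← integral_const_mul, L2.inner_def,
    L2.inner_def, ← integral_add (L2.integrable_inner _ _) (hint.const_mul σ)]
  refine integral_congr_ae ?_
  filter_upwards [coeFn_ladderL2 σ (momentumTest A φ), coeFn_ladderL2 σ (momentumTest A ψ),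
    coeFn_momentumTest (A := A) φ, coeFn_momentumTest (A := A) ψ] with x h₁ h₂ hφ hψ
  rw [h₁, h₂, hφ, hψ, RCLike.inner_apply, PiLp.inner_apply, Fin.sum_univ_two, RCLike.inner_apply,
    RCLike.inner_apply, map_add, map_mul, hσ]
  linear_combination (-momentumFun A ψ x 1 * conj (momentumFun A φ x 1)) * hσ'

theorem norm_eq_one_of_mul_self_eq_neg_one (hσ' : σ * σ = -1) : ‖σ‖ = 1 := by
  have h : ‖σ‖ * ‖σ‖ = 1 := by rw [← norm_mul, hσ', norm_neg, norm_one]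
  exact (mul_self_eq_one_iff.1 h).resolve_right fun h => by linarith [norm_nonneg σ]

theorem inner_ladderL2_of_mem_closure (hA : IsVectorPotential A B) (hσ : conj σ = -σ)
    (hσ' : σ * σ = -1) {p q : L2 × L2Vec} (hp : p ∈ (momentum A).graph.topologicalClosure)
    (hq : q ∈ (momentum A).graph.topologicalClosure) :
    ⟪ladderL2 σ p.2, ladderL2 σ q.2⟫_ℂ =
      ⟪p.2, q.2⟫_ℂ + σ * Complex.I * ⟪p.1, potentialL B q.1⟫_ℂ := by
  have hclosed : IsClosed {r : (L2 × L2Vec) × (L2 × L2Vec) |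
      ⟪ladderL2 σ r.1.2, ladderL2 σ r.2.2⟫_ℂ =
        ⟪r.1.2, r.2.2⟫_ℂ + σ * Complex.I * ⟪r.1.1, potentialL B r.2.1⟫_ℂ} :=
    isClosed_eq (by fun_prop) (by fun_prop)
  have hmem : (p, q) ∈ closure ((momentum A).graph ×ˢ (momentum A).graph :
      Set ((L2 × L2Vec) × (L2 × L2Vec))) := by
    rw [closure_prod_eq]
    exact ⟨hp, hq⟩
  refine closure_minimal ?_ hclosed hmem
  rw [graph_momentum]
  rintro _ ⟨⟨φ, hφ⟩, ⟨ψ, hψ⟩⟩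
  rw [mem_ofPred_eq, ← hφ, ← hψ]
  exact inner_ladderL2_momentumTest hA hσ hσ' φ ψ

theorem norm_le_of_mem_closure (hA : IsVectorPotential A B) (hσ : conj σ = -σ)
    (hσ' : σ * σ = -1) {p : L2 × L2Vec} (hp : p ∈ (momentum A).graph.topologicalClosure) :
    ‖p‖ ≤ (1 + ‖B‖) * ‖ladderProd σ p‖ := by
  have hσn := norm_eq_one_of_mul_self_eq_neg_one hσ'
  set M := ‖ladderProd σ p‖
  have hfst : ‖p.1‖ ≤ M := norm_fst_le (ladderProd σ p)
  have hsnd : ‖ladderL2 σ p.2‖ ≤ M := norm_snd_le (ladderProd σ p)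
  have hB : ‖⟪p.1, potentialL B p.1⟫_ℂ‖ ≤ ‖B‖ * M ^ 2 :=
    calc ‖⟪p.1, potentialL B p.1⟫_ℂ‖ ≤ ‖p.1‖ * (‖B‖ * ‖p.1‖) :=
          (norm_inner_le_norm _ _).trans (by gcongr; exact norm_potential_apply_le B p.1)
      _ ≤ M * (‖B‖ * M) := by gcongr
      _ = ‖B‖ * M ^ 2 := by ring
  have hre : |(σ * Complex.I * ⟪p.1, potentialL B p.1⟫_ℂ).re| ≤ ‖B‖ * M ^ 2 := by
    refine (Complex.abs_re_le_norm _).trans ?_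
    rwa [norm_mul, norm_mul, hσn, Complex.norm_I, one_mul, one_mul]
  have hsq : ‖ladderL2 σ p.2‖ ^ 2 =
      ‖p.2‖ ^ 2 + (σ * Complex.I * ⟪p.1, potentialL B p.1⟫_ℂ).re := by
    rw [← inner_self_eq_norm_sq (𝕜 := ℂ), inner_ladderL2_of_mem_closure hA hσ hσ' hp hp, map_add,
      inner_self_eq_norm_sq]
    rfl
  rw [Prod.norm_def]
  have hM : 0 ≤ M := norm_nonneg _
  refine max_le (by nlinarith [norm_nonneg B]) (abs_le_of_sq_le_sq' ?_ (by positivity) |>.2)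
  calc ‖p.2‖ ^ 2 ≤ ‖ladderL2 σ p.2‖ ^ 2 + ‖B‖ * M ^ 2 := by linarith [(abs_le.1 hre).1]
    _ ≤ (1 + ‖B‖) * M ^ 2 := by rw [one_add_mul]; gcongr
    _ ≤ ((1 + ‖B‖) * M) ^ 2 := by
        rw [mul_pow]
        gcongr
        exact le_self_pow₀ (le_add_of_nonneg_right (norm_nonneg B)) two_ne_zero

end FormDomain

section MagneticLadder

variable {A : C(Plane, Plane)} {B : Plane →ᵇ ℝ} {σ : ℂ} {u g : L2}

theorem closure_minLadder_eq_map (hA : IsVectorPotential A B) (hσ : conj σ = -σ)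
    (hσ' : σ * σ = -1) : (minLadder A σ).topologicalClosure =
      (momentum A).graph.topologicalClosure.map
        (ladderProd σ : L2 × L2Vec →ₗ[ℂ] L2 × L2) := by
  set S := (momentum A).graph.topologicalClosure
  have : CompleteSpace S := (momentum A).graph.isClosed_topologicalClosure.completeSpace_coe
  have hlip : AntilipschitzWith (1 + ‖B‖₊) ((ladderProd σ).comp S.subtypeL) :=
    ContinuousLinearMap.antilipschitz_of_bound _ fun p => norm_le_of_mem_closure hA hσ hσ' p.2
  have hclosed : IsClosed (S.map (ladderProd σ : L2 × L2Vec →ₗ[ℂ] L2 × L2) : Set (L2 × L2)) := by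
    have h := hlip.isClosed_range ((ladderProd σ).comp S.subtypeL).uniformContinuous
    rwa [ContinuousLinearMap.coe_comp, range_comp, Submodule.coe_subtypeL, Submodule.coe_subtype,
      Subtype.range_coe] at h
  refine le_antisymm (Submodule.topologicalClosure_minimal _ ?_ hclosed) ?_
  · rw [← map_ladderProd_graph_momentum]
    exact Submodule.map_mono (Submodule.le_topologicalClosure _)
  · rintro _ ⟨⟨u, w⟩, h, rfl⟩
    exact ladderL2_mem_closure_minLadder h

theorem mem_closure_minLadder_iff (hA : IsVectorPotential A B) (hσ : conj σ = -σ)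
    (hσ' : σ * σ = -1) : (u, g) ∈ (minLadder A σ).topologicalClosure ↔
      ∃ h : u ∈ (momentum A).closure.domain, ladderL2 σ ((momentum A).closure ⟨u, h⟩) = g := by
  rw [closure_minLadder_eq_map hA hσ hσ']
  constructor
  · rintro ⟨⟨v, w⟩, h, hvw⟩
    obtain ⟨rfl, rfl⟩ := Prod.ext_iff.1 hvw
    obtain ⟨hv, hw⟩ := mem_closure_graph_momentum_iff.1 h
    exact ⟨hv, congrArg (ladderL2 σ) hw⟩
  · rintro ⟨h, hg⟩
    exact ⟨(u, _), mem_closure_graph_momentum_iff.2 ⟨h, rfl⟩, Prod.ext rfl hg⟩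

theorem mem_closure_minLadder_iff_forall_inner : (u, g) ∈ (minLadder A σ).topologicalClosure ↔
    ∀ v f, (v, f) ∈ (minLadder A (conj σ)).topologicalClosure → ⟪f, u⟫_ℂ = ⟪v, g⟫_ℂ := by
  simp only [← adjoint_minLadder A σ, ← adjoint_topologicalClosure (minLadder A (conj σ)),
    Submodule.mem_adjoint_iff, sub_eq_zero]

/-- The closure of `π₁ + σ π₂`, on the domain of the closure of `π = p - A`. -/
def ladder (A : C(Plane, Plane)) (σ : ℂ) : (momentum A).closure.domain →ₗ[ℂ] L2 :=
  (ladderL2 σ : L2Vec →ₗ[ℂ] L2) ∘ₗ (momentum A).closure.toFun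

theorem mem_closure_minLadder (hA : IsVectorPotential A B) (hσ : conj σ = -σ)
    (hσ' : σ * σ = -1) (u : (momentum A).closure.domain) :
    ((u : L2), ladder A σ u) ∈ (minLadder A σ).topologicalClosure :=
  (mem_closure_minLadder_iff hA hσ hσ').2 ⟨u.2, rfl⟩

theorem inner_ladder_left (hA : IsVectorPotential A B) (hσ : conj σ = -σ) (hσ' : σ * σ = -1)
    (u v : (momentum A).closure.domain) :
    ⟪ladder A σ u, (v : L2)⟫_ℂ = ⟪(u : L2), ladder A (-σ) v⟫_ℂ :=
  mem_closure_minLadder_iff_forall_inner.1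
    (mem_closure_minLadder hA (by rw [map_neg, hσ]) (by rw [neg_mul_neg, hσ']) v) _ _
    (by rw [map_neg, hσ, neg_neg]; exact mem_closure_minLadder hA hσ hσ' u)

theorem ladder_eq_of_forall_inner (hA : IsVectorPotential A B) (hσ : conj σ = -σ)
    (hσ' : σ * σ = -1)
    (h : ∀ v : (momentum A).closure.domain, ⟪ladder A (-σ) v, u⟫_ℂ = ⟪(v : L2), g⟫_ℂ) :
    ∃ hu : u ∈ (momentum A).closure.domain, ladder A σ ⟨u, hu⟩ = g := by
  refine (mem_closure_minLadder_iff hA hσ hσ').1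
    (mem_closure_minLadder_iff_forall_inner.2 fun v f hvf => ?_)
  rw [hσ, mem_closure_minLadder_iff hA (by rw [map_neg, hσ]) (by rw [neg_mul_neg, hσ'])] at hvf
  obtain ⟨hv, rfl⟩ := hvf
  exact h ⟨v, hv⟩

theorem inner_ladder_ladder (hA : IsVectorPotential A B) (hσ : conj σ = -σ) (hσ' : σ * σ = -1)
    (u v : (momentum A).closure.domain) : ⟪ladder A σ u, ladder A σ v⟫_ℂ =
      ⟪(momentum A).closure u, (momentum A).closure v⟫_ℂ +
        σ * Complex.I * ⟪(u : L2), potentialL B v⟫_ℂ :=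
  inner_ladderL2_of_mem_closure hA hσ hσ' (mem_closure_graph_momentum_iff.2 ⟨u.2, rfl⟩)
    (mem_closure_graph_momentum_iff.2 ⟨v.2, rfl⟩)

/-- The annihilation and creation operators `π₁ ± i π₂` of a magnetic field `B`, whose commutator
is `2 B`. -/
def magneticLadder (hA : IsVectorPotential A B) : LadderPair L2 where
  dom := (momentum A).closure.domain
  a := ladder A Complex.I
  c := ladder A (-Complex.I)
  β := potentialL (2 • B)
  inner_a := inner_ladder_left hA Complex.conj_I Complex.I_mul_I
  a_max _ _ h := ladder_eq_of_forall_inner hA Complex.conj_I Complex.I_mul_I h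
  c_max _ _ h := ladder_eq_of_forall_inner hA (by simp) (by simp) (by rwa [neg_neg])
  comm u v := by
    rw [inner_ladder_ladder hA (by simp) (by simp), inner_ladder_ladder hA (by simp) (by simp),
      two_nsmul, map_add, add_apply, inner_add_right, neg_mul, Complex.I_mul_I]
    ring

end MagneticLadder

section Hamiltonian

theorem mem_graph_adjointCompClosure_iff (D : L2 →ₗ.[ℂ] L2Vec) {u f : L2} :
    (u, f) ∈ (adjointCompClosure D).graph ↔
      ∃ h : u ∈ D.closure.domain, (D.closure ⟨u, h⟩, f) ∈ D†.graph := by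
  simp only [LinearPMap.mem_graph_iff]
  constructor
  · rintro ⟨⟨_, ⟨v, hv, rfl⟩, hu⟩, rfl, hf⟩
    exact ⟨hu, ⟨D.closure v, hv⟩, rfl, hf⟩
  · rintro ⟨hu, ⟨_, hw⟩, rfl, hf⟩
    exact ⟨⟨u, ⟨⟨u, hu⟩, hw, rfl⟩, hu⟩, rfl, hf⟩

variable {A : C(Plane, Plane)} {B V : Plane →ᵇ ℝ}

theorem mem_graph_adjoint_momentum_iff {w : L2Vec} {f : L2} : (w, f) ∈ (momentum A)†.graph ↔
    ∀ v : (momentum A).closure.domain, ⟪(momentum A).closure v, w⟫_ℂ = ⟪(v : L2), f⟫_ℂ := by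
  rw [LinearPMap.adjoint_graph_eq_graph_adjoint dense_range_testToL2,
    ← adjoint_topologicalClosure, Submodule.mem_adjoint_iff]
  constructor
  · intro h v
    exact sub_eq_zero.1 (h _ _ (mem_closure_graph_momentum_iff.2 ⟨v.2, rfl⟩))
  · intro h v _ hmem
    obtain ⟨hv, rfl⟩ := mem_closure_graph_momentum_iff.1 hmem
    exact sub_eq_zero.2 (h ⟨v, hv⟩)

theorem graph_adjointCompClosure_momentum (hA : IsVectorPotential A B) :
    (adjointCompClosure (momentum A)).graph =
      addBounded (magneticLadder hA).kinetic (potentialL B) := by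
  ext ⟨u, f⟩
  rw [mem_graph_adjointCompClosure_iff, mem_addBounded, LadderPair.mem_kinetic_iff]
  refine exists_congr fun hu => mem_graph_adjoint_momentum_iff.trans (forall_congr' fun v => ?_)
  change _ ↔ ⟪ladder A Complex.I v, ladder A Complex.I ⟨u, hu⟩⟫_ℂ = ⟪(v : L2), f - _⟫_ℂ
  rw [inner_ladder_ladder hA Complex.conj_I Complex.I_mul_I, Complex.I_mul_I, neg_one_mul,
    ← sub_eq_add_neg, inner_sub_right]
  exact sub_left_inj.symm

theorem graph_hamiltonian (hA : IsVectorPotential A B) (V : Plane →ᵇ ℝ) :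
    (hamiltonian A V).graph = addBounded (magneticLadder hA).kinetic (potentialL (B + V)) := by
  rw [map_add, ← addBounded_addBounded, ← graph_adjointCompClosure_momentum hA]
  ext ⟨u, f⟩
  rw [mem_addBounded, LinearPMap.mem_graph_iff, LinearPMap.mem_graph_iff]
  refine exists_congr fun v => and_congr_right ?_
  rintro rfl
  exact eq_sub_iff_add_eq'.symm

theorem coe_mem_resolventSet {T : L2 →ₗ.[ℂ] L2} (hT : T.graph.adjoint = T.graph) {E K : ℝ}
    (hK : IsBoundedBelow
      (addBounded T.graph (potentialL (BoundedContinuousFunction.const Plane (-E)))) K) :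
    (E : ℂ) ∈ resolventSet T := by
  have hE (u : L2) :
      potentialL (BoundedContinuousFunction.const Plane (-E)) u = -((E : ℂ) • u) := by
    rw [potentialL_const_apply, Complex.ofReal_neg, neg_smul]
  obtain ⟨R, hR⟩ := hK.exists_inverse (adjoint_addBounded hT inner_potentialL_left)
  have hR' (u f : L2) : (u, f + (E : ℂ) • u) ∈ T.graph ↔ R f = u := by
    rw [← hR, mem_addBounded, hE, sub_neg_eq_add]
  refine ⟨R, fun f => ?_, fun ψ => (hR' _ _).1 ?_⟩
  · obtain ⟨⟨_, h⟩, rfl, hf⟩ := (LinearPMap.mem_graph_iff _).1 ((hR' (R f) f).2 rfl)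
    exact ⟨h, sub_eq_of_eq_add hf⟩
  · rw [sub_add_cancel]
    exact T.mem_graph ψ

end Hamiltonian

section Commutator

variable {A : C(Plane, Plane)} {B W : Plane →ᵇ ℝ} {σ : ℂ}

theorem gradSup_nonneg (f : Plane → ℝ) : 0 ≤ gradSup f := Real.iSup_nonneg fun _ => norm_nonneg _

theorem norm_fderiv_le_gradSup {f : Plane → ℝ} (hf : HasBoundedGradient f) (x : Plane) :
    ‖fderiv ℝ f x‖ ≤ gradSup f := le_ciSup hf.2 x

theorem norm_dbar_ofReal_le {f : Plane → ℝ} (hf : HasBoundedGradient f) (σ : ℂ) (x : Plane) :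
    ‖dbar σ (fun y => (f y : ℂ)) x‖ ≤ (1 + ‖σ‖) * gradSup f := by
  have h : fderiv ℝ (fun y => (f y : ℂ)) x = Complex.ofRealCLM.comp (fderiv ℝ f x) :=
    (Complex.ofRealCLM.hasFDerivAt.comp x (hf.1 x).hasFDerivAt).fderiv
  refine (norm_dbar_le σ _ x).trans ?_
  gcongr
  calc ‖fderiv ℝ (fun y => (f y : ℂ)) x‖ ≤ ‖Complex.ofRealCLM‖ * ‖fderiv ℝ f x‖ :=
        h ▸ ContinuousLinearMap.opNorm_comp_le _ _
    _ ≤ gradSup f := by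
        rw [Complex.ofRealCLM_norm, one_mul]
        exact norm_fderiv_le_gradSup hf x

theorem memLp_dbar_ofReal {f : Plane → ℝ} (hf : HasBoundedGradient f) (σ : ℂ) :
    MemLp (dbar σ fun y => (f y : ℂ)) ⊤ volume :=
  memLp_top_of_bound (measurable_dbar σ _).aestronglyMeasurable _
    (Eventually.of_forall (norm_dbar_ofReal_le hf σ))

/-- Multiplication by `(p₁ + σ p₂) f`, the commutator of `π₁ + σ π₂` with multiplication by `f`. -/
def commutatorL {f : Plane → ℝ} (hf : HasBoundedGradient f) (σ : ℂ) : L2 →L[ℂ] L2 :=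
  (ContinuousLinearMap.mul ℂ ℂ).holderL volume ⊤ 2 2 (memLp_dbar_ofReal hf σ).toLp

theorem coeFn_commutatorL {f : Plane → ℝ} (hf : HasBoundedGradient f) (σ : ℂ) (u : L2) :
    commutatorL hf σ u =ᵐ[volume] fun x => dbar σ (fun y => (f y : ℂ)) x * u x := by
  filter_upwards [(memLp_dbar_ofReal hf σ).coeFn_toLp,
    (ContinuousLinearMap.mul ℂ ℂ).coeFn_holder (r := 2) (memLp_dbar_ofReal hf σ).toLp u]
    with x hdbar hx
  exact hx.trans (by rw [hdbar, ContinuousLinearMap.mul_apply'])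

theorem norm_commutatorL_apply_le {f : Plane → ℝ} (hf : HasBoundedGradient f) (σ : ℂ) (u : L2) :
    ‖commutatorL hf σ u‖ ≤ (1 + ‖σ‖) * gradSup f * ‖u‖ := by
  refine Lp.norm_le_mul_norm_of_ae_le_mul ?_
  filter_upwards [coeFn_commutatorL hf σ u] with x hx
  rw [hx, norm_mul]
  gcongr
  exact norm_dbar_ofReal_le hf σ x

theorem potentialL_testToL2_mem_closure (hW : HasBoundedGradient W) (φ : Test) :
    (potentialL W (testToL2 φ),
      potentialL W (ladderTest A σ φ) + commutatorL hW σ (testToL2 φ)) ∈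
      (minLadder A σ).topologicalClosure := by
  rw [← adjoint_minLadder, mem_adjoint_minLadder_iff]
  have hWd : Differentiable ℝ fun x => (W x : ℂ) := fun x =>
    Complex.ofRealCLM.differentiableAt.comp x (hW.1 x)
  have hWφ (x : Plane) : ladderFun A σ ((fun x => (W x : ℂ)) * φ) x =
      W x * ladderFun A σ φ x + dbar σ (fun x => (W x : ℂ)) x * φ x :=
    ladderFun_mul (hWd x) (differentiable_test φ x)
  have hint : LocallyIntegrable (dbar σ ((fun x => (W x : ℂ)) * φ)) := by
    refine ((hWd.continuous.mul (continuous_dbar (σ := σ) (contDiff_test φ))).locallyIntegrable.add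
      (((memLp_dbar_ofReal hW σ).locallyIntegrable le_top).continuous_mul φ.continuous)).congr ?_
    exact Eventually.of_forall fun x => (dbar_mul (hWd x) (differentiable_test φ x)).symm
  refine (isWeakLadder_ladderFun (hWd.mul (differentiable_test φ)) hint).congr ?_ ?_
  · filter_upwards [coeFn_potential W (testToL2 φ), coeFn_testToL2 φ] with x hx hφ
    rw [potentialL_apply, hx, hφ, Pi.mul_apply]
  · filter_upwards [Lp.coeFn_add (potentialL W (ladderTest A σ φ)) (commutatorL hW σ (testToL2 φ)),
      coeFn_potential W (ladderTest A σ φ), coeFn_ladderTest σ φ, coeFn_testToL2 φ,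
      coeFn_commutatorL hW σ (testToL2 φ)] with x hadd hWx hladder hφ hcomm
    rw [hadd, Pi.add_apply, potentialL_apply, hWx, hladder, hcomm, hφ, hWφ]

theorem potentialL_mem_closure_minLadder (hW : HasBoundedGradient W) {u g : L2}
    (h : (u, g) ∈ (minLadder A σ).topologicalClosure) :
    (potentialL W u, potentialL W g + commutatorL hW σ u) ∈
      (minLadder A σ).topologicalClosure := by
  let T (p : L2 × L2) : L2 × L2 := (potentialL W p.1, potentialL W p.2 + commutatorL hW σ p.1)
  have hT : MapsTo T (minLadder A σ) (minLadder A σ).topologicalClosure := by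
    rintro _ ⟨φ, rfl⟩
    exact potentialL_testToL2_mem_closure hW φ
  exact (minLadder A σ).isClosed_topologicalClosure.closure_subset
    (map_mem_closure (f := T) (by fun_prop) h hT)

theorem norm_ladder_potentialL_sub_le (hA : IsVectorPotential A B) (hσ : conj σ = -σ)
    (hσ' : σ * σ = -1) (hW : HasBoundedGradient W) (u : (momentum A).closure.domain) :
    ∃ h : potentialL W u ∈ (momentum A).closure.domain,
      ‖ladder A σ ⟨potentialL W u, h⟩ - potentialL W (ladder A σ u)‖ ≤
        2 * gradSup W * ‖(u : L2)‖ := by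
  obtain ⟨h, hWu⟩ := (mem_closure_minLadder_iff hA hσ hσ').1
    (potentialL_mem_closure_minLadder hW (mem_closure_minLadder hA hσ hσ' u))
  refine ⟨h, ?_⟩
  have hσn : 1 + ‖σ‖ = 2 := by rw [norm_eq_one_of_mul_self_eq_neg_one hσ', one_add_one_eq_two]
  rw [show ladder A σ ⟨potentialL W u, h⟩ = _ from hWu, add_sub_cancel_left, ← hσn]
  exact norm_commutatorL_apply_le hW σ u

theorem commBound_potentialL (hA : IsVectorPotential A B) (hW : HasBoundedGradient W) {G : ℝ}
    (hG : 2 * gradSup W ≤ G) : (magneticLadder hA).CommBound (potentialL W) G := fun u => by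
  obtain ⟨h, ha⟩ := norm_ladder_potentialL_sub_le hA Complex.conj_I Complex.I_mul_I hW u
  obtain ⟨_, hc⟩ := norm_ladder_potentialL_sub_le hA (σ := -Complex.I) (by simp) (by simp) hW u
  have hGu : 2 * gradSup W * ‖(u : L2)‖ ≤ G * ‖(u : L2)‖ := by gcongr
  exact ⟨h, ha.trans hGu, hc.trans hGu⟩

end Commutator

section Gap

/-- The function `(2 k + 1) B + V - E`, the `k`-th Landau level of the frozen field and potential
relative to the energy `E`. -/
def levelFun (B V : Plane →ᵇ ℝ) (E : ℝ) (k : ℕ) : Plane →ᵇ ℝ :=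
  B + V + BoundedContinuousFunction.const Plane (-E) + k • 2 • B

theorem levelFun_apply (B V : Plane →ᵇ ℝ) (E : ℝ) (k : ℕ) (x : Plane) :
    levelFun B V E k x = (2 * k + 1) * B x + V x - E := by
  change B x + V x + -E + k • (2 • B x) = _
  rw [nsmul_eq_mul, nsmul_eq_mul, Nat.cast_ofNat]
  ring

variable {A : C(Plane, Plane)} {B V : Plane →ᵇ ℝ}

theorem gradSup_levelFun (hB : HasBoundedGradient B) (hV : HasBoundedGradient V) (E : ℝ) (k : ℕ) :
    HasBoundedGradient (levelFun B V E k) ∧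
      gradSup (levelFun B V E k) ≤ (2 * k + 1) * gradSup B + gradSup V := by
  have hderiv (x : Plane) : HasFDerivAt (levelFun B V E k)
      ((2 * k + 1 : ℝ) • fderiv ℝ B x + fderiv ℝ V x) x := by
    rw [funext (levelFun_apply B V E k)]
    exact (((hB.1 x).hasFDerivAt.const_mul _).add (hV.1 x).hasFDerivAt).sub_const E
  have hnorm (x : Plane) :
      ‖fderiv ℝ (levelFun B V E k) x‖ ≤ (2 * k + 1) * gradSup B + gradSup V := by
    rw [(hderiv x).fderiv]
    refine norm_add_le_of_le ?_ (norm_fderiv_le_gradSup hV x)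
    rw [norm_smul, Real.norm_of_nonneg (by positivity)]
    gcongr
    exact norm_fderiv_le_gradSup hB x
  exact ⟨⟨fun x => (hderiv x).differentiableAt, _, forall_mem_range.2 hnorm⟩, ciSup_le hnorm⟩

theorem mem_resolventSet_of_isBoundedBelow (hA : IsVectorPotential A B) {E K : ℝ}
    (hK : IsBoundedBelow
      (addBounded (magneticLadder hA).kinetic (potentialL (levelFun B V E 0))) K) :
    (E : ℂ) ∈ resolventSet (hamiltonian A V) := by
  refine coe_mem_resolventSet (K := K) ?_ ?_ <;> rw [graph_hamiltonian hA]
  · exact adjoint_addBounded (magneticLadder hA).adjoint_kinetic inner_potentialL_left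
  · rwa [addBounded_addBounded, ← map_add, ← add_zero (B + V + _), ← zero_smul ℕ (2 • B)]

theorem potentialL_levelFun_zero_add (hA : IsVectorPotential A B) (E : ℝ) (k : ℕ) :
    potentialL (levelFun B V E 0) + k • (magneticLadder hA).β = potentialL (levelFun B V E k) := by
  rw [levelFun, levelFun, zero_smul, add_zero, map_add _ _ (k • 2 • B), map_nsmul _ k]
  rfl

theorem isBoundedBelow_levelFun (hA : IsVectorPotential A B) (hB : HasBoundedGradient B)
    (hV : HasBoundedGradient V) {b₀ b₁ d s E : ℝ} {n : ℕ} (hb₀ : 0 < b₀) (hBb₀ : ∀ x, b₀ ≤ B x)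
    (hBb₁ : ∀ x, B x ≤ b₁) (hd : 0 < d) (hs : √(2 * (n + 1) * b₁) ≤ s * √(2 * b₀))
    (hlow : ∀ x, (2 * n + 1) * B x + V x ≤ E - d) (hup : ∀ x, E + d ≤ (2 * n + 3) * B x + V x)
    (hgrad : 8 * LadderPair.resolventConst s (n + 1) * ((2 * n + 1) * gradSup B + gradSup V) ≤
      d * √(2 * b₀)) :
    IsBoundedBelow (addBounded (magneticLadder hA).kinetic (potentialL (levelFun B V E 0)))
      (LadderPair.resolventConst s (n + 1) / d) := by
  have hBpos (x : Plane) : 0 < B x := hb₀.trans_le (hBb₀ x)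
  have hB₀ : 0 ≤ gradSup B := gradSup_nonneg B
  have hV₀ : 0 ≤ gradSup V := gradSup_nonneg V
  have hk_le {k : ℕ} (hk : k < n + 1) : (k : ℝ) ≤ n := by exact_mod_cast Nat.lt_succ_iff.1 hk
  have hΛ (x : Plane) : 2 * (n + 1) * B x ≤ 2 * (n + 1) * b₁ := by
    gcongr
    exact hBb₁ x
  refine LadderPair.isBoundedBelow_of_ladder (β₀ := 2 * b₀) (Λ := 2 * (n + 1) * b₁)
    (G := 2 * ((2 * n + 1) * gradSup B + gradSup V)) (by positivity) ?_ hd ?_ hs (by positivity)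
    (n + 1) (by linarith) _ (fun k hk => ?_) (fun k hk => ?_) (fun k _ => ?_) ?_
  · refine smul_one_le_potentialL fun x => ?_
    simpa using hBb₀ x
  · nlinarith [hlow 0, hup 0, hΛ 0, hBpos 0]
  · obtain ⟨hgradient, hle⟩ := gradSup_levelFun hB hV E k
    rw [potentialL_levelFun_zero_add]
    refine commBound_potentialL hA hgradient ?_
    nlinarith [hk_le hk]
  · rw [potentialL_levelFun_zero_add, ← map_neg]
    refine smul_one_le_potentialL fun x => ?_
    rw [BoundedContinuousFunction.neg_apply, levelFun_apply]
    nlinarith [hlow x, hk_le hk, hBpos x]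
  · rw [potentialL_levelFun_zero_add]
    refine smul_one_le_potentialL fun x => ?_
    rw [levelFun_apply]
    nlinarith [hup x, hΛ x, mul_nonneg k.cast_nonneg (hBpos x).le]
  · rw [potentialL_levelFun_zero_add]
    refine smul_one_le_potentialL fun x => ?_
    rw [levelFun_apply]
    push_cast
    linarith [hup x]

end Gap

section BandEdges

theorem le_eMax (V B : Plane →ᵇ ℝ) (n : ℕ) (x : Plane) : (2 * n + 1) * B x + V x ≤ eMax V B n :=
  le_ciSup (((2 * n + 1 : ℝ) • B + V).isBounded_range.bddAbove) x

theorem eMin_le (V B : Plane →ᵇ ℝ) (n : ℕ) (x : Plane) : eMin V B n ≤ (2 * n + 1) * B x + V x :=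
  ciInf_le (((2 * n + 1 : ℝ) • B + V).isBounded_range.bddBelow) x

theorem K2_nonneg (B V : Plane → ℝ) : 0 ≤ K2 B V :=
  add_nonneg (gradSup_nonneg B) (gradSup_nonneg V)

/-- The constant for the gap between the bands `n` and `n + 1` alone. -/
def gapConst (C₁ : ℝ) (n : ℕ) : ℝ :=
  8 * LadderPair.resolventConst ((n + 1) * C₁) (n + 1) * (2 * n + 1) / √(2 * C₁⁻¹)

variable {C₁ B₀ : ℝ}

theorem gapConst_nonneg (hC₁ : 0 < C₁) (n : ℕ) : 0 ≤ gapConst C₁ n := by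
  have := LadderPair.one_le_resolventConst (s := (n + 1) * C₁) (by positivity) (n + 1)
  unfold gapConst
  positivity

theorem sqrt_le_mul_sqrt (hC₁ : 0 < C₁) (hB₀ : 0 < B₀) (n : ℕ) :
    √(2 * (n + 1) * (C₁ * B₀)) ≤ (n + 1) * C₁ * √(2 * (C₁⁻¹ * B₀)) := by
  refine Real.sqrt_le_iff.2 ⟨by positivity, ?_⟩
  rw [mul_pow, Real.sq_sqrt (by positivity)]
  have hsq : ((n + 1) * C₁) ^ 2 * (2 * (C₁⁻¹ * B₀)) = (n + 1) * (2 * (n + 1) * (C₁ * B₀)) := by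
    field_simp
  rw [hsq]
  exact le_mul_of_one_le_left (by positivity) (by linarith [n.cast_nonneg (α := ℝ)])

theorem resolventConst_mul_le (hC₁ : 0 < C₁) (hB₀ : 0 < B₀) (n : ℕ) (B V : Plane → ℝ) :
    8 * LadderPair.resolventConst ((n + 1) * C₁) (n + 1) * ((2 * n + 1) * gradSup B + gradSup V) ≤
      gapConst C₁ n * (K2 B V * B₀ ^ (-(1 / 2) : ℝ)) * √(2 * (C₁⁻¹ * B₀)) := by
  set M := LadderPair.resolventConst ((n + 1) * C₁) (n + 1)
  have hM₁ : 1 ≤ M := LadderPair.one_le_resolventConst (by positivity) _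
  have hgap : gapConst C₁ n * √(2 * C₁⁻¹) = 8 * M * (2 * n + 1) :=
    div_mul_cancel₀ _ (by positivity)
  have hsqrt : √(2 * (C₁⁻¹ * B₀)) = √(2 * C₁⁻¹) * √B₀ := by
    rw [← mul_assoc, Real.sqrt_mul (by positivity)]
  have hpow : B₀ ^ (-(1 / 2) : ℝ) * √B₀ = 1 := by
    rw [Real.sqrt_eq_rpow, ← Real.rpow_add hB₀, neg_add_cancel, Real.rpow_zero]
  have hgrad : (2 * n + 1) * gradSup B + gradSup V ≤ (2 * n + 1) * K2 B V := by
    rw [K2, mul_add]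
    gcongr
    exact le_mul_of_one_le_left (gradSup_nonneg V) (by linarith [n.cast_nonneg (α := ℝ)])
  calc 8 * M * ((2 * n + 1) * gradSup B + gradSup V)
      ≤ 8 * M * ((2 * n + 1) * K2 B V) := by gcongr
    _ = (gapConst C₁ n * √(2 * C₁⁻¹)) * K2 B V * (B₀ ^ (-(1 / 2) : ℝ) * √B₀) := by
        rw [hgap, hpow]
        ring
    _ = _ := by
        rw [hsqrt]
        ring

theorem mem_resolventSet_of_mem_Ioo {A : C(Plane, Plane)} {B V : Plane →ᵇ ℝ} (hC₁ : 0 < C₁)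
    (hB₀ : 0 < B₀) (hB : HasBoundedGradient B) (hV : HasBoundedGradient V)
    (hBB₀ : ∀ x, C₁⁻¹ * B₀ ≤ B x ∧ B x ≤ C₁ * B₀) (hA : IsVectorPotential A B) {n : ℕ} {E : ℝ}
    (hE : E ∈ Ioo (eMax V B n + gapConst C₁ n * (K2 B V * B₀ ^ (-(1 / 2) : ℝ)))
      (eMin V B (n + 1) - gapConst C₁ n * (K2 B V * B₀ ^ (-(1 / 2) : ℝ)))) :
    (E : ℂ) ∈ resolventSet (hamiltonian A V) := by
  set d := min (E - eMax V B n) (eMin V B (n + 1) - E)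
  set δ := gapConst C₁ n * (K2 B V * B₀ ^ (-(1 / 2) : ℝ))
  have hδ₀ : 0 ≤ δ := mul_nonneg (gapConst_nonneg hC₁ n) <|
    mul_nonneg (K2_nonneg B V) (Real.rpow_nonneg hB₀.le _)
  have hδd : δ < d := lt_min (by linarith [hE.1]) (by linarith [hE.2])
  refine mem_resolventSet_of_isBoundedBelow hA
    (isBoundedBelow_levelFun hA hB hV (n := n) (by positivity) (fun x => (hBB₀ x).1)
      (fun x => (hBB₀ x).2) (hδ₀.trans_lt hδd) (sqrt_le_mul_sqrt hC₁ hB₀ n) (fun x => ?_)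
      (fun x => ?_) ((resolventConst_mul_le hC₁ hB₀ n B V).trans ?_))
  · linarith [le_eMax V B n x, min_le_left (E - eMax V B n) (eMin V B (n + 1) - E)]
  · have := eMin_le V B (n + 1) x
    push_cast at this
    linarith [min_le_right (E - eMax V B n) (eMin V B (n + 1) - E)]
  · gcongr

theorem exists_eq_coe_boundedContinuous (hC₁ : 0 < C₁) (hB₀ : 0 < B₀) {B : Plane → ℝ}
    (hB : HasBoundedGradient B) (hBB₀ : ∀ x, C₁⁻¹ * B₀ ≤ B x ∧ B x ≤ C₁ * B₀) :
    ∃ f : Plane →ᵇ ℝ, f = B := by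
  refine ⟨.ofNormedAddCommGroup B hB.1.continuous (C₁ * B₀) fun x => ?_, rfl⟩
  rw [Real.norm_of_nonneg ((by positivity : 0 ≤ C₁⁻¹ * B₀).trans (hBB₀ x).1)]
  exact (hBB₀ x).2

theorem hasBoundedGradient_const_add {f : Plane → ℝ} (c : ℝ) (hf : HasBoundedGradient f) :
    HasBoundedGradient fun x => c + f x :=
  ⟨hf.1.const_add c, by simpa only [fderiv_const_add] using hf.2⟩

theorem gradSup_const_add (c : ℝ) (f : Plane → ℝ) : gradSup (fun x => c + f x) = gradSup f := by
  simp only [gradSup, fderiv_const_add]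

theorem K2_mul_rpow_le_correction (hB₀ : 0 ≤ B₀) (B₁ V : Plane → ℝ) :
    K2 (fun x => B₀ + B₁ x) V * B₀ ^ (-(1 / 2) : ℝ) ≤ correction B₀ B₁ V := by
  rw [K2, gradSup_const_add]
  exact le_add_of_nonneg_right (mul_nonneg (sq_nonneg _) (Real.rpow_nonneg hB₀ _))

end BandEdges

end

end MagneticSchrodinger

open MagneticSchrodinger in
theorem theorem3p1_general (C₁ : ℝ) (hC₁ : 0 < C₁) :
    ∃ Cext : ℕ → ℝ, (∀ n, 0 ≤ Cext n) ∧
      ∀ (B₀ : ℝ) (B : Plane → ℝ) (V : Plane →ᵇ ℝ) (A : C(Plane, Plane)),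
        0 < B₀ →
        HasBoundedGradient B →
        HasBoundedGradient V →
        (∀ x, C₁⁻¹ * B₀ ≤ B x ∧ B x ≤ C₁ * B₀) →
        IsVectorPotential A B →
        ∀ n : ℕ, ∀ E : ℝ,
          E ∈ Set.Ioo (eMax V B n + Cext n * (K2 B V * B₀ ^ (-(1 / 2) : ℝ)))
            (eMin V B (n + 1) - Cext (n + 1) * (K2 B V * B₀ ^ (-(1 / 2) : ℝ))) →
          (E : ℂ) ∈ MagneticSchrodinger.resolventSet (hamiltonian A V) := by
  have hgap := gapConst_nonneg hC₁
  -- The index `n - 1` serves the gap below the `n`-th band.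
  refine ⟨fun n => gapConst C₁ n + gapConst C₁ (n - 1),
    fun n => add_nonneg (hgap _) (hgap _), fun B₀ B V A hB₀ hB hV hBB₀ hA n E hE => ?_⟩
  obtain ⟨B, rfl⟩ := exists_eq_coe_boundedContinuous hC₁ hB₀ hB hBB₀
  have hK : 0 ≤ K2 B V * B₀ ^ (-(1 / 2) : ℝ) :=
    mul_nonneg (K2_nonneg _ _) (Real.rpow_nonneg hB₀.le _)
  refine mem_resolventSet_of_mem_Ioo hC₁ hB₀ hB hV hBB₀ hA (n := n)
    (Ioo_subset_Ioo ?_ ?_ hE)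
  · gcongr
    exact le_add_of_nonneg_right (hgap _)
  · gcongr
    exact le_add_of_nonneg_left (hgap _)

open MagneticSchrodinger in
theorem theorem3p1 (C₁ : ℝ) (hC₁ : 0 < C₁) :
    ∃ Cext : ℕ → ℝ, (∀ n, 0 ≤ Cext n) ∧
      ∀ (B₀ : ℝ) (B₁ B : Plane → ℝ) (V : Plane →ᵇ ℝ) (A : C(Plane, Plane)),
        0 < B₀ →
        (∀ x, B x = B₀ + B₁ x) →
        HasBoundedGradient B₁ →
        HasBoundedGradient V →
        (∀ x, C₁⁻¹ * B₀ ≤ B x ∧ B x ≤ C₁ * B₀) →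
        IsVectorPotential A B →
        ∀ n : ℕ, ∀ E : ℝ,
          E ∈ Set.Ioo (eMax V B n + Cext n * correction B₀ B₁ V)
            (eMin V B (n + 1) - Cext (n + 1) * correction B₀ B₁ V) →
          (E : ℂ) ∈ MagneticSchrodinger.resolventSet (hamiltonian A V) := by
  obtain ⟨Cext, hCext, hgap⟩ := theorem3p1_general C₁ hC₁
  refine ⟨Cext, hCext, fun B₀ B₁ B V A hB₀ hBB₁ hB₁ hV hBB₀ hA n E hE => ?_⟩
  obtain rfl : B = fun x => B₀ + B₁ x := funext hBB₁
  have hK := K2_mul_rpow_le_correction hB₀.le B₁ V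
  refine hgap B₀ _ V A hB₀ (hasBoundedGradient_const_add B₀ hB₁) hV hBB₀ hA n E
    (Ioo_subset_Ioo ?_ ?_ hE)
  · gcongr
    exact hCext n
  · gcongr
    exact hCext (n + 1)
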